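/- Let $k$ be a field, let $H$ be a Hopf algebra over $k$ with comultiplication $\Delta(h)=\sum h_{(1)}\otimes h_{(2)}$ and antipode $S$ (not assumed bijective), and let $A$ be a left $H$-module algebra, i.e. an associative unital $k$-algebra with a left $H$-module structure such that $h(ab)=\sum (h_{(1)}a)(h_{(2)}b)$ for all $h\in H$, $a,b\in A$. Suppose that $A$ is right Noetherian and $H$-semiprime, the latter meaning that $A$ contains no nonzero nilpotent $H$-stable two-sided ideals. Let $\mathcal E'_H$ be the set of all right ideals $I$ of $A$ such that for each $h\in S(H)$ one has $hJ\subseteq I$ for some essential right ideal $J$ of $A$ (a right ideal is essential if it has nonzero intersection with each nonzero right ideal). Then $\mathcal E'_H$ is a Gabriel topology, that is, a nonempty set $\mathcal G$ of right ideals such that, with $(I:a)=\{x\in A\mid ax\in I\}$ and $I,J$ denoting right ideals of $A$, 1. if $J\in\mathcal G$ and $J\subseteq I$, then $I\in\mathcal G$; 2. if $I,J\in\mathcal G$, then $I\cap J\in\mathcal G$; 3. if $I\in\mathcal G$, then $(I:a)\in\mathcal G$ for each $a\in A$; 4. if $J\in\mathcal G$ and $(I:a)\in\mathcal G$ for all $a\in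 J$, then $I\in\mathcal G$. Moreover $A$ is $\mathcal E'_H$-torsionfree: if $a\in A$ and $aI=0$ for some $I\in\mathcal E'_H$, then $a=0$. Hence there is the quotient ring of $A$ with respect to $\mathcal E'_H$, $$Q=\varinjlim_{I\in\mathcal E'_H}\mathrm{Hom}_A(I,A)$$ (homomorphisms of right $A$-modules), in which the product of the classes of $\alpha:I\to A$ and $\beta:J\to A$ is the class of $\alpha\circ\beta:\beta^{-1}(I)\to A$, and which contains $A$ as the subring of the classes of left multiplications. The ring $Q$ is semiprimary, i.e. its Jacobson radical is nilpotent and the factor ring of $Q$ by the Jacobson radical is semisimple Artinian. Furthermore, there is an action of $H$ on $Q$ that extends the given action on $A$ and makes $Q$ an $H$-semiprime left $H$-module algebra. -/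

import Mathlib

/-! ### Right ideals and Gabriel topologies -/

section RightIdeals

universe u

/-- Right ideals of a ring `R`: submodules of `R` as a right module over itself. -/
abbrev RightIdeal (R : Type u) [Ring R] : Type u := Submodule Rᵐᵒᵖ R

/-- Left multiplication by `a`, as a homomorphism of right `R`-modules `R → R`. -/
def leftMulHom {R : Type u} [Ring R] (a : R) : R →ₗ[Rᵐᵒᵖ] R where
  toFun x := a * x
  map_add' x y := mul_add a x y
  map_smul' c x := (mul_assoc a x c.unop).symm

/-- The right ideal `(I : a) = {x ∈ R | a x ∈ I}`. -/
def RightIdeal.colon {R : Type u} [Ring R] (I : RightIdeal R) (a : R) : RightIdeal R :=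
  Submodule.comap (leftMulHom a) I

/-- A right ideal is essential if it meets each nonzero right ideal nontrivially. -/
def RightIdeal.IsEssential {R : Type u} [Ring R] (I : RightIdeal R) : Prop :=
  ∀ K : RightIdeal R, K ≠ ⊥ → I ⊓ K ≠ ⊥

/-- A right Gabriel topology on `R`: a nonempty set of right ideals satisfying (T1)-(T4). -/
structure RightGabrielTopology (R : Type u) [Ring R] where
  /-- The right ideals belonging to the topology. -/
  carrier : Set (RightIdeal R)
  top_mem : ⊤ ∈ carrier
  mem_of_le : ∀ I J : RightIdeal R, J ∈ carrier → J ≤ I → I ∈ carrier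
  inf_mem : ∀ I J : RightIdeal R, I ∈ carrier → J ∈ carrier → I ⊓ J ∈ carrier
  colon_mem : ∀ I : RightIdeal R, I ∈ carrier → ∀ a : R, I.colon a ∈ carrier
  mem_of_colon_mem : ∀ I J : RightIdeal R, J ∈ carrier →
    (∀ a ∈ J, I.colon a ∈ carrier) → I ∈ carrier

/-- `R` is torsionfree as a right module over itself: no nonzero element of `R` is annihilated
by a right ideal from the topology. -/
def RightGabrielTopology.IsTorsionFree {R : Type u} [Ring R] (G : RightGabrielTopology R) : Prop :=
  ∀ I ∈ G.carrier, ∀ a : R, (∀ x ∈ I, a * x = 0) → a = 0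

end RightIdeals

/-! ### The quotient ring `lim Hom_R(I, R)`, `I ∈ G` -/

section QuotientRing

universe u v

namespace RightGabrielTopology

variable {R : Type u} [Ring R] (G : RightGabrielTopology R)

/-- The pairs `(I, α)` where `I` is a right ideal from `G` and `α : I → R` is right `R`-linear. -/
abbrev PartialHom : Type u := {f : R →ₗ.[Rᵐᵒᵖ] R // f.domain ∈ G.carrier}

variable {G}

/-- The composition `α ∘ β`, defined on `β⁻¹(I)`, where `I` is the domain of `α`. -/
def compPMap (f g : R →ₗ.[Rᵐᵒᵖ] R) : R →ₗ.[Rᵐᵒᵖ] R where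
  domain := (f.domain.comap g.toFun).map g.domain.subtype
  toFun :=
    { toFun := fun x => f ⟨g ⟨x.1, by
          obtain ⟨y, _, hy⟩ := x.2
          exact hy ▸ y.2⟩, by
          obtain ⟨y, hy, hyx⟩ := x.2
          have : y = ⟨x.1, hyx ▸ y.2⟩ := Subtype.ext hyx
          exact this ▸ hy⟩
      map_add' := fun x y => by
        rw [← f.map_add]
        congr 1
        ext1
        exact g.map_add ⟨x.1, _⟩ ⟨y.1, _⟩
      map_smul' := fun c x => by
        rw [RingHom.id_apply, ← f.map_smul]
        congr 1
        ext1
        exact g.map_smul c ⟨x.1, _⟩ }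

theorem mem_compPMap_domain {f g : R →ₗ.[Rᵐᵒᵖ] R} {x : R} :
    x ∈ (compPMap f g).domain ↔ ∃ h : x ∈ g.domain, g ⟨x, h⟩ ∈ f.domain := by
  constructor
  · rintro ⟨y, hy, rfl⟩
    exact ⟨y.2, hy⟩
  · rintro ⟨h, hx⟩
    exact ⟨⟨x, h⟩, hx, rfl⟩

theorem compPMap_apply {f g : R →ₗ.[Rᵐᵒᵖ] R} {x : R} (h : x ∈ (compPMap f g).domain)
    (h₁ : x ∈ g.domain) (h₂ : g ⟨x, h₁⟩ ∈ f.domain) :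
    compPMap f g ⟨x, h⟩ = f ⟨g ⟨x, h₁⟩, h₂⟩ := rfl

theorem compPMap_domain_mem {f g : R →ₗ.[Rᵐᵒᵖ] R} (hf : f.domain ∈ G.carrier)
    (hg : g.domain ∈ G.carrier) : (compPMap f g).domain ∈ G.carrier := by
  refine G.mem_of_colon_mem _ _ hg fun a ha => ?_
  refine G.mem_of_le _ _ (G.colon_mem _ hf (g ⟨a, ha⟩)) fun x hx => ?_
  have key : g ⟨a * x, g.domain.smul_mem (MulOpposite.op x) ha⟩ = g ⟨a, ha⟩ * x :=
    g.map_smul (MulOpposite.op x) ⟨a, ha⟩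
  refine mem_compPMap_domain.2 ⟨g.domain.smul_mem (MulOpposite.op x) ha, ?_⟩
  exact key.symm ▸ hx

namespace PartialHom

instance : Add G.PartialHom := ⟨fun f g => ⟨f.1 + g.1, G.inf_mem _ _ f.2 g.2⟩⟩
instance : Neg G.PartialHom := ⟨fun f => ⟨-f.1, f.2⟩⟩
instance : Zero G.PartialHom := ⟨⟨0, G.top_mem⟩⟩
instance : Mul G.PartialHom := ⟨fun f g => ⟨compPMap f.1 g.1, compPMap_domain_mem f.2 g.2⟩⟩

/-- Left multiplication by `a`, defined on the whole `R`. -/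
def of (a : R) : G.PartialHom := ⟨(leftMulHom a).toPMap ⊤, G.top_mem⟩

instance : One G.PartialHom := ⟨of 1⟩

/-- Two partial homomorphisms agree on the right ideal `K`, contained in both domains. -/
def EqOn (f g : G.PartialHom) (K : RightIdeal R) : Prop :=
  ∀ x ∈ K, ∃ (hf : x ∈ f.1.domain) (hg : x ∈ g.1.domain), f.1 ⟨x, hf⟩ = g.1 ⟨x, hg⟩

variable (G)

/-- Two partial homomorphisms have equal images in the direct limit over `G` if and only if they
agree on some right ideal from `G` contained in both domains. -/
instance setoid : Setoid G.PartialHom where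
  r f g := ∃ K ∈ G.carrier, EqOn f g K
  iseqv :=
    { refl := fun f => ⟨_, f.2, fun _ hx => ⟨hx, hx, rfl⟩⟩
      symm := fun ⟨K, hK, h⟩ => ⟨K, hK, fun x hx => by
        obtain ⟨h₁, h₂, h₃⟩ := h x hx
        exact ⟨h₂, h₁, h₃.symm⟩⟩
      trans := fun ⟨K, hK, h⟩ ⟨L, hL, h'⟩ => ⟨K ⊓ L, G.inf_mem _ _ hK hL, fun x hx => by
        obtain ⟨h₁, h₂, h₃⟩ := h x hx.1
        obtain ⟨h₄, h₅, h₆⟩ := h' x hx.2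
        exact ⟨h₁, h₅, h₃.trans h₆⟩⟩ }

variable {G}

theorem equiv_iff {f g : G.PartialHom} : f ≈ g ↔ ∃ K ∈ G.carrier, EqOn f g K := Iff.rfl

/-- Partial homomorphisms agreeing wherever both are defined are equivalent. -/
theorem equiv_of_agree {f g : G.PartialHom}
    (h : ∀ x (hf : x ∈ f.1.domain) (hg : x ∈ g.1.domain), f.1 ⟨x, hf⟩ = g.1 ⟨x, hg⟩) : f ≈ g :=
  ⟨_, G.inf_mem _ _ f.2 g.2, fun x hx => ⟨hx.1, hx.2, h x hx.1 hx.2⟩⟩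

theorem mem_add {f g : G.PartialHom} {x : R} (h : x ∈ (f + g).1.domain) :
    x ∈ f.1.domain ∧ x ∈ g.1.domain := h

theorem add_val {f g : G.PartialHom} {x : R} (h : x ∈ (f + g).1.domain) :
    (f + g).1 ⟨x, h⟩ = f.1 ⟨x, (mem_add h).1⟩ + g.1 ⟨x, (mem_add h).2⟩ := rfl

theorem neg_val {f : G.PartialHom} {x : R} (h : x ∈ (-f).1.domain) :
    (-f).1 ⟨x, h⟩ = -f.1 ⟨x, h⟩ := rfl

theorem zero_val {x : R} (h : x ∈ (0 : G.PartialHom).1.domain) :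
    (0 : G.PartialHom).1 ⟨x, h⟩ = 0 := rfl

theorem of_val (a : R) {x : R} (h : x ∈ (of a : G.PartialHom).1.domain) :
    (of a : G.PartialHom).1 ⟨x, h⟩ = a * x := rfl

theorem one_val {x : R} (h : x ∈ (1 : G.PartialHom).1.domain) :
    (1 : G.PartialHom).1 ⟨x, h⟩ = x := one_mul x

theorem mem_mul {f g : G.PartialHom} {x : R} :
    x ∈ (f * g).1.domain ↔ ∃ h : x ∈ g.1.domain, g.1 ⟨x, h⟩ ∈ f.1.domain := mem_compPMap_domain

theorem mul_val {f g : G.PartialHom} {x : R} (h : x ∈ (f * g).1.domain) :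
    (f * g).1 ⟨x, h⟩ =
      f.1 ⟨g.1 ⟨x, (mem_mul.1 h).choose⟩, (mem_mul.1 h).choose_spec⟩ := rfl

theorem val_congr (f : G.PartialHom) {x y : R} (hxy : x = y) (hx : x ∈ f.1.domain)
    (hy : y ∈ f.1.domain) : f.1 ⟨x, hx⟩ = f.1 ⟨y, hy⟩ := by
  subst hxy; rfl

theorem val_add (f : G.PartialHom) {x y : R} (hx : x ∈ f.1.domain) (hy : y ∈ f.1.domain)
    (hxy : x + y ∈ f.1.domain) : f.1 ⟨x + y, hxy⟩ = f.1 ⟨x, hx⟩ + f.1 ⟨y, hy⟩ :=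
  f.1.map_add ⟨x, hx⟩ ⟨y, hy⟩

theorem val_mul (f : G.PartialHom) {x : R} (c : R) (hx : x ∈ f.1.domain)
    (hxc : x * c ∈ f.1.domain) : f.1 ⟨x * c, hxc⟩ = f.1 ⟨x, hx⟩ * c :=
  f.1.map_smul (MulOpposite.op c) ⟨x, hx⟩

theorem add_congr {f f' g g' : G.PartialHom} (hf : f ≈ f') (hg : g ≈ g') :
    f + g ≈ f' + g' := by
  obtain ⟨K, hK, h⟩ := hf
  obtain ⟨L, hL, h'⟩ := hg
  refine ⟨K ⊓ L, G.inf_mem _ _ hK hL, fun x hx => ?_⟩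
  obtain ⟨h₁, h₂, h₃⟩ := h x hx.1
  obtain ⟨h₄, h₅, h₆⟩ := h' x hx.2
  exact ⟨⟨h₁, h₄⟩, ⟨h₂, h₅⟩, congrArg₂ (· + ·) h₃ h₆⟩

theorem neg_congr {f f' : G.PartialHom} (hf : f ≈ f') : -f ≈ -f' := by
  obtain ⟨K, hK, h⟩ := hf
  refine ⟨K, hK, fun x hx => ?_⟩
  obtain ⟨h₁, h₂, h₃⟩ := h x hx
  exact ⟨h₁, h₂, by rw [neg_val, neg_val, h₃]⟩

theorem mul_congr {f f' g g' : G.PartialHom} (hf : f ≈ f') (hg : g ≈ g') :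
    f * g ≈ f' * g' := by
  obtain ⟨K, hK, h⟩ := hf
  obtain ⟨L, hL, h'⟩ := hg
  -- the right ideal of all `x ∈ L` with `g x ∈ K`
  let p : R →ₗ.[Rᵐᵒᵖ] R := (LinearMap.id : R →ₗ[Rᵐᵒᵖ] R).toPMap K
  have hM : (compPMap p g.1).domain ∈ G.carrier := compPMap_domain_mem hK g.2
  refine ⟨(compPMap p g.1).domain ⊓ L, G.inf_mem _ _ hM hL, fun x hx => ?_⟩
  obtain ⟨hxg, hgK⟩ := mem_compPMap_domain.1 hx.1
  obtain ⟨_, h₅, h₆⟩ := h' x hx.2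
  obtain ⟨h₁, h₂, h₃⟩ := h _ hgK
  refine ⟨mem_mul.2 ⟨hxg, h₁⟩, mem_mul.2 ⟨h₅, h₆ ▸ h₂⟩, ?_⟩
  rw [mul_val, mul_val, h₃]
  exact val_congr f' h₆ _ _

end PartialHom

variable (G)

/-- The quotient ring of `R` with respect to `G`: the direct limit of the groups `Hom_R(I, R)` over
the right ideals `I ∈ G`, the product of the classes of `α` and `β` being the class of `α ∘ β`. -/
def QuotientRing : Type u := Quotient (PartialHom.setoid G)

namespace QuotientRing

variable {G}

/-- The element of the quotient ring represented by `f`. -/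
def mk (f : G.PartialHom) : G.QuotientRing := Quotient.mk _ f

theorem mk_eq_mk {f g : G.PartialHom} :
    mk f = mk g ↔ ∃ K ∈ G.carrier, PartialHom.EqOn f g K := Quotient.eq

theorem mk_surjective : Function.Surjective (mk (G := G)) := Quotient.mk_surjective

theorem mk_eq_of_agree {f g : G.PartialHom}
    (h : ∀ x (hf : x ∈ f.1.domain) (hg : x ∈ g.1.domain), f.1 ⟨x, hf⟩ = g.1 ⟨x, hg⟩) :
    mk f = mk g := Quotient.sound (PartialHom.equiv_of_agree h)

instance : Zero G.QuotientRing := ⟨mk 0⟩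
instance : One G.QuotientRing := ⟨mk 1⟩
instance : Add G.QuotientRing :=
  ⟨Quotient.map₂ (· + ·) fun _ _ h _ _ h' => PartialHom.add_congr h h'⟩
instance : Neg G.QuotientRing := ⟨Quotient.map (- ·) fun _ _ h => PartialHom.neg_congr h⟩
instance : Mul G.QuotientRing :=
  ⟨Quotient.map₂ (· * ·) fun _ _ h _ _ h' => PartialHom.mul_congr h h'⟩

theorem mk_zero : mk (0 : G.PartialHom) = 0 := rfl
theorem mk_one : mk (1 : G.PartialHom) = 1 := rfl
theorem mk_add (f g : G.PartialHom) : mk (f + g) = mk f + mk g := rfl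
theorem mk_neg (f : G.PartialHom) : mk (-f) = -mk f := rfl
theorem mk_mul (f g : G.PartialHom) : mk (f * g) = mk f * mk g := rfl

instance : Ring G.QuotientRing where
  add_assoc := by
    rintro ⟨f⟩ ⟨g⟩ ⟨h⟩
    exact mk_eq_of_agree fun x _ _ => add_assoc _ _ _
  zero_add := by
    rintro ⟨f⟩
    exact mk_eq_of_agree fun x _ _ => zero_add _
  add_zero := by
    rintro ⟨f⟩
    exact mk_eq_of_agree fun x _ _ => add_zero _
  add_comm := by
    rintro ⟨f⟩ ⟨g⟩
    exact mk_eq_of_agree fun x _ _ => add_comm _ _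
  neg_add_cancel := by
    rintro ⟨f⟩
    exact mk_eq_of_agree fun x _ _ => neg_add_cancel _
  mul_assoc := by
    rintro ⟨f⟩ ⟨g⟩ ⟨h⟩
    exact mk_eq_of_agree fun x _ _ => rfl
  one_mul := by
    rintro ⟨f⟩
    exact mk_eq_of_agree fun x _ _ => one_mul _
  mul_one := by
    rintro ⟨f⟩
    exact mk_eq_of_agree fun x _ _ => PartialHom.val_congr f (one_mul x) _ _
  zero_mul := by
    rintro ⟨f⟩
    exact mk_eq_of_agree fun x _ _ => rfl
  mul_zero := by
    rintro ⟨f⟩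
    exact mk_eq_of_agree fun x _ _ => f.1.map_zero
  left_distrib := by
    rintro ⟨f⟩ ⟨g⟩ ⟨h⟩
    exact mk_eq_of_agree fun x h₁ h₂ => PartialHom.val_add f
      (PartialHom.mem_mul.1 h₂.1).choose_spec (PartialHom.mem_mul.1 h₂.2).choose_spec _
  right_distrib := by
    rintro ⟨f⟩ ⟨g⟩ ⟨h⟩
    exact mk_eq_of_agree fun x _ _ => rfl
  nsmul := nsmulRec
  zsmul := zsmulRec

variable (G)

/-- The canonical homomorphism `R → R_G`: an element goes to the class of the left multiplication
by it. It is injective if and only if `R` is torsionfree. -/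
def of : R →+* G.QuotientRing where
  toFun a := mk (PartialHom.of a)
  map_one' := rfl
  map_zero' := mk_eq_of_agree fun x _ _ => zero_mul x
  map_add' a b := mk_eq_of_agree fun x _ _ => add_mul a b x
  map_mul' a b := mk_eq_of_agree fun x _ _ => mul_assoc a b x

/-- The canonical map is injective when `R` is torsionfree. -/
theorem of_injective (hG : G.IsTorsionFree) : Function.Injective (of G) := by
  intro a b hab
  obtain ⟨K, hK, h⟩ := mk_eq_mk.1 hab
  refine sub_eq_zero.1 (hG K hK (a - b) fun x hx => ?_)
  obtain ⟨_, _, h₃⟩ := h x hx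
  rw [sub_mul, sub_eq_zero]
  exact h₃

/-- If `R` is a `k`-algebra then so is the quotient ring. -/
instance {k : Type v} [CommRing k] [Algebra k R] : Algebra k G.QuotientRing :=
  ((of G).comp (algebraMap k R)).toAlgebra' fun c q => by
    obtain ⟨f, rfl⟩ := mk_surjective q
    refine mk_eq_of_agree fun x h₁ h₂ => ?_
    have hx : x ∈ f.1.domain := (PartialHom.mem_mul.1 h₁).choose
    have hc : algebraMap k R c * x = x * algebraMap k R c := Algebra.commutes c x
    have hxc : x * algebraMap k R c ∈ f.1.domain :=
      f.1.domain.smul_mem (MulOpposite.op (algebraMap k R c)) hx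
    calc algebraMap k R c * f.1 ⟨x, hx⟩ = f.1 ⟨x, hx⟩ * algebraMap k R c :=
          Algebra.commutes c _
      _ = f.1 ⟨x * algebraMap k R c, hxc⟩ := (PartialHom.val_mul f _ hx hxc).symm
      _ = f.1 ⟨algebraMap k R c * x, hc ▸ hxc⟩ := PartialHom.val_congr f hc.symm _ _

end QuotientRing

end RightGabrielTopology

end QuotientRing

/-! ### Module algebras over Hopf algebras -/

section HopfModuleAlgebras

universe u v w

/-- A `k`-algebra `A` with a (`k`-linear) left `H`-module structure is an `H`-module algebra if
`h(ab) = ∑ (h₍₁₎ a)(h₍₂₎ b)`. As `H` has an antipode, `h 1 = ε(h) 1` is a consequence. -/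
class IsModuleAlgebra (k : Type u) (H : Type v) (A : Type w) [Field k] [Ring H] [HopfAlgebra k H]
    [Ring A] [Algebra k A] [Module H A] : Prop extends IsScalarTower k H A where
  smul_mul : ∀ (h : H) (a b : A), h • (a * b) =
    LinearMap.mul' k A (TensorProduct.map
      ((LinearMap.toSpanSingleton H A a).restrictScalars k)
      ((LinearMap.toSpanSingleton H A b).restrictScalars k) (Coalgebra.comul (R := k) h))

/-- `A` is `H`-semiprime if it contains no nonzero nilpotent `H`-stable (two-sided) ideals. -/
def IsHSemiprime (H : Type v) (A : Type w) [Ring H] [Ring A] [Module H A] : Prop :=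
  ∀ I : Ideal A, I.IsTwoSided → (∀ (h : H), ∀ a ∈ I, h • a ∈ I) → IsNilpotent I → I = ⊥

/-- The set of all right ideals `I` of `A` such that for each `h ∈ S(H)`, where `S` is the antipode
of `H`, one has `h J ⊆ I` for some essential right ideal `J` of `A`. -/
def hEssentialFilter (k : Type u) (H : Type v) (A : Type w) [Field k] [Ring H] [HopfAlgebra k H]
    [Ring A] [Module H A] : Set (RightIdeal A) :=
  {I | ∀ h ∈ Set.range (HopfAlgebra.antipode k : H → H),
    ∃ J : RightIdeal A, J.IsEssential ∧ ∀ x ∈ J, h • x ∈ I}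

end HopfModuleAlgebras

/-! Right ideals of `A` are submodules over `Aᵐᵒᵖ`, so the one-sided ring theory is proved for left
Noetherian rings and applied to `Aᵐᵒᵖ`.

Every `h : H` is a combination of entries of a finite comatrix `e`, with `Δ(e i j) = ∑ e i l ⊗ e l
j` and `S(e)` inverse to `e`. The elements sent into a right ideal `I` by all `S(e i j)` form a
right ideal, `antipodeComap`, and `I` is in the filter iff all these are essential. Products of
comatrices are comatrices, so the filter is closed under `antipodeComap`. Therefore the elements
killing a member of the filter form an `H`-stable ideal. It lies in a nilpotent ideal `N` with
semiprime quotient, so it vanishes by `H`-semiprimeness. This is torsionfreeness, from which (T4)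
follows.

Goldie's theorem modulo `N`, combined with induction along the powers of `N`, shows that in a
descending chain of right ideals each late term is dense in the preceding one with respect to
elements regular modulo `N` (`eventually_isDenseIn`). The crux is that right ideals dense in this
sense belong to the filter. For this, density must pass to `antipodeComap`; that is proved with rows
on which `A` acts through `S(e)`, a module which is Noetherian without inverting `S`. Descending
chains of right annihilators in `Q` then stop, as do ascending ones by Noetherianity, left
cancellable elements are units, and the radical is nil; a general criterion makes `Q` semiprimary.

For the action, a partial homomorphism is extended `k`-linearly to `A` and acted on by `(h f)(x) = ∑
h₍₁₎ f(S(h₍₂₎) x)`. On a suitable `antipodeComap` the result is right linear and independent of the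
extension. The module algebra laws are checked in `End_k(A)` and transferred by torsionfreeness. -/

/-! ### Nil ideals and Goldie's theorem for left Noetherian rings -/

section LeftNoetherian

universe u v

/-- Levitzki's trick: if `a` has maximal annihilator modulo the ideal `L` among the elements
`a * r ∉ L`, and each `a * r` is nilpotent modulo `L`, then `a R a ⊆ L`. -/
theorem mul_mul_mem_of_maximal {R : Type u} [Ring R] (L : Ideal R) [L.IsTwoSided] {a : R}
    (hmax : ∀ r : R, a * r ∉ L → ∀ x, x * (a * r) ∈ L → x * a ∈ L)
    (hnil : ∀ r : R, ∃ n : ℕ, (a * r) ^ n ∈ L) (c : R) : a * c * a ∈ L := by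
  classical
  have hex := hnil c
  set n := Nat.find hex with hn
  have hmem : (a * c) ^ n ∈ L := Nat.find_spec hex
  rcases n with _ | n
  · have : (1 : R) ∈ L := by simpa using hmem
    simpa using L.mul_mem_left (a * c * a) this
  rcases n with _ | n
  · exact L.mul_mem_right _ (by simpa using hmem)
  -- With the exponent least, the preceding power is `a * r ∉ L` and is killed by `a * c` modulo
  -- `L`; by maximality `a * c` kills `a` too.
  · have hnot : (a * c) ^ (n + 1) ∉ L := Nat.find_min hex (by omega)
    have heq : (a * c) ^ (n + 1) = a * (c * (a * c) ^ n) := by rw [pow_succ', mul_assoc]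
    rw [heq] at hnot
    refine hmax _ hnot (a * c) ?_
    rw [← heq, ← pow_succ']
    exact hmem

/-- Noetherianity applied to the left annihilators modulo `L`; it supplies the maximality needed in
Levitzki's trick. -/
theorem exists_maximal_annihilator {R : Type u} [Ring R] [IsNoetherianRing R] (L : Ideal R)
    (S : Set R) (hS : ∃ a ∈ S, a ∉ L) :
    ∃ a ∈ S, a ∉ L ∧ ∀ b ∈ S, b ∉ L → (∀ x, x * a ∈ L → x * b ∈ L) →
      ∀ x, x * b ∈ L → x * a ∈ L := by
  let f : R → Ideal R := fun a => Submodule.comap (LinearMap.toSpanSingleton R R a) L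
  have hf : ∀ a x, x ∈ f a ↔ x * a ∈ L := fun a x => by simp [f]
  obtain ⟨I, ⟨a, ⟨haS, haL⟩, rfl⟩, hI⟩ := wellFounded_gt.has_min (f '' {a | a ∈ S ∧ a ∉ L})
    (hS.elim fun a ha => ⟨f a, a, ha, rfl⟩)
  refine ⟨a, haS, haL, fun b hb hbL hab x hx => ?_⟩
  by_contra hxa
  refine hI (f b) ⟨b, ⟨hb, hbL⟩, rfl⟩ (lt_of_le_of_ne (fun y hy => ?_) fun h => ?_)
  · exact (hf b y).2 (hab y ((hf a y).1 hy))
  · exact hxa ((hf a x).1 (h ▸ (hf b x).2 hx))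

/-- In a left Noetherian ring there is a nilpotent two-sided ideal with semiprime quotient. -/
theorem exists_nilpotent_semiprime_ideal (R : Type u) [Ring R] [IsNoetherianRing R] :
    ∃ N : Ideal R, N.IsTwoSided ∧ IsNilpotent N ∧ ∀ a, (∀ c, a * c * a ∈ N) → a ∈ N := by
  obtain ⟨N, ⟨hN, hnil⟩, hmax⟩ := wellFounded_gt.has_min
    {I : Ideal R | I.IsTwoSided ∧ IsNilpotent I} ⟨⊥, inferInstance, 1, by simp⟩
  refine ⟨N, hN, hnil, fun a ha => ?_⟩
  -- `K` is the two-sided ideal generated by `a`. Since `N ⊔ K` has square inside `N`, it is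
  -- nilpotent, and maximality of `N` forces `a ∈ N`.
  let K : Ideal R := Ideal.span (Set.range fun r => a * r)
  have haK : a ∈ K := Ideal.subset_span ⟨1, mul_one a⟩
  have hK : K.IsTwoSided := ⟨fun {x} b hx => by
    induction hx using Submodule.span_induction with
    | mem x hx =>
      obtain ⟨r, rfl⟩ := hx
      exact Ideal.subset_span ⟨r * b, (mul_assoc _ _ _).symm⟩
    | zero => simp
    | add x y _ _ hx hy => rw [add_mul]; exact K.add_mem hx hy
    | smul c x _ hx => rw [smul_mul_assoc]; exact K.smul_mem _ hx⟩
  have hKK : ∀ x ∈ K, ∀ y ∈ K, x * y ∈ N := fun x hx y hy => by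
    have hay : ∀ r, a * r * y ∈ N := by
      clear hx
      induction hy using Submodule.span_induction with
      | mem y hy =>
        obtain ⟨r, rfl⟩ := hy
        intro c
        rw [← mul_assoc]
        exact N.mul_mem_right _ (ha c)
      | zero => simp
      | add x y _ _ hx hy => intro c; rw [mul_add]; exact N.add_mem (hx c) (hy c)
      | smul d x _ hx => intro c; rw [smul_eq_mul, ← mul_assoc, mul_assoc a]; exact hx _
    induction hx using Submodule.span_induction with
    | mem x hx => obtain ⟨r, rfl⟩ := hx; exact hay r
    | zero => simp
    | add x z _ _ hx hz => rw [add_mul]; exact N.add_mem hx hz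
    | smul c x _ hx => rw [smul_eq_mul, mul_assoc]; exact N.mul_mem_left _ hx
  have hsq : (N ⊔ K) ^ 2 ≤ N := by
    rw [Submodule.pow_succ, Submodule.pow_one, Ideal.mul_le]
    intro x hx y hy
    obtain ⟨n, hn, k, hk, rfl⟩ := Submodule.mem_sup.1 hx
    obtain ⟨n', hn', k', hk', rfl⟩ := Submodule.mem_sup.1 hy
    rw [add_mul, mul_add k]
    exact N.add_mem (N.mul_mem_right _ hn) (N.add_mem (N.mul_mem_left _ hn') (hKK _ hk _ hk'))
  have hts : (N ⊔ K).IsTwoSided := ⟨fun {x} b hx => by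
    obtain ⟨n, hn, k, hk, rfl⟩ := Submodule.mem_sup.1 hx
    rw [add_mul]
    exact Submodule.add_mem_sup (N.mul_mem_right _ hn) (K.mul_mem_right _ hk)⟩
  have hpow : ∀ m : ℕ, (N ⊔ K) ^ (2 * m) ≤ N ^ m := fun m => by
    induction m with
    | zero => exact le_of_eq (by rw [Nat.mul_zero, Submodule.pow_zero, Submodule.pow_zero])
    | succ m ih =>
      rw [Nat.mul_succ, Ideal.IsTwoSided.pow_add, Submodule.pow_succ]
      exact Ideal.mul_mono ih hsq
  have hle : ¬ N < N ⊔ K := by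
    obtain ⟨m, hm⟩ := hnil
    exact hmax _ ⟨hts, 2 * m, le_bot_iff.1 ((hpow m).trans hm.le)⟩
  have : N ⊔ K = N := (le_sup_left.lt_or_eq.resolve_left hle).symm
  exact this ▸ (le_sup_right : K ≤ N ⊔ K) haK

/-- In a left Noetherian ring, a left ideal which is nil modulo a semiprime ideal is contained in
that ideal. -/
theorem le_of_nil_modulo {R : Type u} [Ring R] [IsNoetherianRing R] (N : Ideal R) [N.IsTwoSided]
    (hN : ∀ a, (∀ c, a * c * a ∈ N) → a ∈ N) (I : Ideal R)
    (hI : ∀ x ∈ I, ∃ n : ℕ, x ^ n ∈ N) : I ≤ N := by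
  intro a ha
  by_contra haN
  obtain ⟨b, ⟨r, rfl⟩, hbN, hb⟩ := exists_maximal_annihilator N (Set.range fun r => a * r)
    ⟨a, ⟨1, mul_one a⟩, haN⟩
  refine hbN (hN _ (mul_mul_mem_of_maximal N (fun s hs => hb _ ⟨r * s, (mul_assoc _ _ _).symm⟩ hs
    fun x hx => ?_) fun s => ?_))
  · simpa [mul_assoc] using N.mul_mem_right s hx
  · obtain ⟨n, hn⟩ := hI (r * s * a) (I.mul_mem_left _ ha)
    refine ⟨n + 1, ?_⟩
    -- Nilpotency modulo `N` is carried from the left ideal `I` to the right multiples of `a`, among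
    -- which the maximal annihilator was chosen.
    have key : ∀ m : ℕ, (a * r * s) ^ (m + 1) = a * (r * s * a) ^ m * (r * s) := by
      intro m
      induction m with
      | zero => simp [mul_assoc]
      | succ m ih => rw [pow_succ, ih, pow_succ]; simp only [mul_assoc]
    rw [key]
    exact N.mul_mem_right _ (N.mul_mem_left _ hn)

/-- In a left Noetherian ring, elements with essential left annihilator are nilpotent. -/
theorem isNilpotent_of_essential_annihilator {R : Type u} [Ring R] [IsNoetherianRing R] (a : R)
    (ha : ∀ K : Ideal R, K ≠ ⊥ → ∃ x ∈ K, x ≠ 0 ∧ x * a = 0) : IsNilpotent a := by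
  let f : ℕ →o Ideal R := ⟨fun n => LinearMap.ker (LinearMap.toSpanSingleton R R (a ^ n)), by
    refine monotone_nat_of_le_succ fun n x hx => ?_
    simp only [LinearMap.mem_ker, LinearMap.toSpanSingleton_apply, smul_eq_mul] at hx ⊢
    rw [pow_succ, ← mul_assoc, hx, zero_mul]⟩
  have hf : ∀ n x, x ∈ f n ↔ x * a ^ n = 0 := fun n x => by simp [f]
  obtain ⟨n, hn⟩ := monotone_stabilizes_iff_noetherian.2 (inferInstance : IsNoetherian R R) f
  refine ⟨n, ?_⟩
  by_contra h
  -- If `a ^ n ≠ 0`, some nonzero `y * a ^ n` is killed by `a`; then `y` kills `a ^ (n + 1)`, hence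
  -- already `a ^ n`.
  obtain ⟨x, hx, hx0, hxa⟩ := ha (Ideal.span {a ^ n}) (by simpa [Ideal.span_singleton_eq_bot])
  obtain ⟨y, rfl⟩ := Ideal.mem_span_singleton'.1 hx
  refine hx0 ((hf n y).1 ?_)
  rw [hn (n + 1) n.le_succ, hf, pow_succ, ← mul_assoc, hxa]

/-- A Noetherian module has no infinite descending sequence of submodules with each one not
essential in the preceding one. -/
theorem wellFounded_not_essential (R : Type u) (M : Type v) [Ring R] [AddCommGroup M] [Module R M]
    [IsNoetherian R M] : WellFounded fun X' X : Submodule R M =>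
      X' ≤ X ∧ ∃ K ≤ X, K ≠ ⊥ ∧ Disjoint K X' := by
  rw [wellFounded_iff_isEmpty_descending_chain]
  refine ⟨fun ⟨X, hX⟩ => ?_⟩
  choose hle K hK hK0 hdis using hX
  have hanti : Antitone X := antitone_nat_of_succ_le hle
  -- The sum of the `K n` is direct, since `K (n + 1)` lies in `X (n + 1)`, which misses the earlier
  -- ones. So the partial sums would ascend strictly.
  let S : ℕ →o Submodule R M := partialSups K
  have hS : ∀ n, Disjoint (S n) (X (n + 1)) := by
    intro n
    induction n with
    | zero => simpa [S] using hdis 0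
    | succ n ih =>
      rw [Submodule.disjoint_def] at ih ⊢
      intro x hx hxX
      have hx' : x ∈ S n ⊔ K (n + 1) := by simpa [S, partialSups_add_one] using hx
      obtain ⟨s, hs, k, hk, rfl⟩ := Submodule.mem_sup.1 hx'
      have hs0 : s = 0 := by
        refine ih s hs ?_
        have h1 : s + k ∈ X (n + 1) := hanti (Nat.le_succ _) hxX
        simpa using (X (n + 1)).sub_mem h1 (hK (n + 1) hk)
      subst hs0
      rw [zero_add] at hxX ⊢
      exact (Submodule.disjoint_def.1 (hdis (n + 1))) k hk hxX
  obtain ⟨n, hn⟩ := monotone_stabilizes_iff_noetherian.2 ‹IsNoetherian R M› S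
  have h1 : K (n + 1) ≤ S n := by
    rw [hn (n + 1) n.le_succ]
    exact le_partialSups K (n + 1)
  exact hK0 (n + 1) (le_bot_iff.1 ((hS n) h1 (hK (n + 1))))

end LeftNoetherian

/-! ### Regular elements in essential left ideals -/

section Goldie

universe u v

/-- A nonzero left ideal contains a non-nilpotent element, and the annihilators of its powers
stabilize; a high positive power works. -/
theorem exists_mem_annihilator_sq {B : Type u} [Ring B] [IsNoetherianRing B]
    (hB : ∀ a : B, (∀ c, a * c * a = 0) → a = 0) {I : Ideal B} (hI : I ≠ ⊥) :
    ∃ a ∈ I, a ≠ 0 ∧ ∀ x, x * a * a = 0 → x * a = 0 := by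
  have : ∃ x ∈ I, ∀ n : ℕ, x ^ n ≠ 0 := by
    by_contra! h
    exact hI (le_bot_iff.1 (le_of_nil_modulo ⊥ (by simpa using hB) I (by simpa using h)))
  obtain ⟨x, hxI, hx⟩ := this
  let f : ℕ →o Ideal B := ⟨fun n => LinearMap.ker (LinearMap.toSpanSingleton B B (x ^ n)), by
    refine monotone_nat_of_le_succ fun n y hy => ?_
    simp only [LinearMap.mem_ker, LinearMap.toSpanSingleton_apply, smul_eq_mul] at hy ⊢
    rw [pow_succ, ← mul_assoc, hy, zero_mul]⟩
  have hf : ∀ n y, y ∈ f n ↔ y * x ^ n = 0 := fun n y => by simp [f]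
  obtain ⟨n, hn⟩ := monotone_stabilizes_iff_noetherian.2 (inferInstance : IsNoetherian B B) f
  refine ⟨x ^ (n + 1), I.pow_mem_of_mem hxI _ n.succ_pos, hx _, fun y hy => ?_⟩
  rw [mul_assoc, ← pow_add, ← hf, ← hn _ (by omega), hn (n + 1) (by omega), hf] at hy
  exact hy

/-- Goldie's regular element argument. If `c ∈ I` still has a nonzero annihilator, essentiality of
`I` yields `a ∈ l c ⊓ I` with `l a = l (a * a)`, and passing to `c + a` cuts the annihilator down by
the nonzero `B a`. -/
theorem exists_right_cancel_mem_of_essential {B : Type u} [Ring B] [IsNoetherianRing B]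
    (hB : ∀ a : B, (∀ c, a * c * a = 0) → a = 0) {I : Ideal B}
    (hI : ∀ K : Ideal B, K ≠ ⊥ → K ⊓ I ≠ ⊥) : ∃ c ∈ I, ∀ x, x * c = 0 → x = 0 := by
  let l : B → Ideal B := fun a => LinearMap.ker (LinearMap.toSpanSingleton B B a)
  have hl : ∀ a x, x ∈ l a ↔ x * a = 0 := fun a x => by simp [l]
  obtain ⟨_, ⟨c, hc, hcc, rfl⟩, hmin⟩ := (wellFounded_not_essential B B).has_min
    {X | ∃ c ∈ I, (∀ x, x * c * c = 0 → x * c = 0) ∧ X = l c ⊓ I}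
    ⟨_, 0, I.zero_mem, by simp, rfl⟩
  refine ⟨c, hc, fun x hx => ?_⟩
  by_contra hx0
  have h0 : l c ≠ ⊥ := fun h => hx0 (by
    have : x ∈ l c := (hl c x).2 hx
    rwa [h, Submodule.mem_bot] at this)
  obtain ⟨a, ha, ha0, haa⟩ := exists_mem_annihilator_sq hB (hI _ h0)
  have hac : a * c = 0 := (hl _ _).1 ha.1
  -- Multiplying by `c` on the right removes `a` because `a * c = 0`; so the annihilator of `c + a`
  -- is the intersection of those of `c` and `a`.
  have hsplit : ∀ y, y * (c + a) = 0 → y * c = 0 ∧ y * a = 0 := fun y hy => by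
    rw [mul_add] at hy
    have h1 : y * c = 0 := hcc y (by
      have := congrArg (· * c) hy
      simpa [add_mul, mul_assoc, hac] using this)
    exact ⟨h1, by simpa [h1] using hy⟩
  refine hmin (l (c + a) ⊓ I) ⟨c + a, I.add_mem hc ha.2, fun y hy => ?_, rfl⟩
    ⟨fun y hy => ⟨?_, hy.2⟩, Ideal.span {a}, ?_, ?_, ?_⟩
  · obtain ⟨h1, h2⟩ := hsplit _ hy
    have h3 : y * c = 0 := hcc y (by simpa [mul_add, add_mul, mul_assoc, hac] using h1)
    have h4 : y * a = 0 := haa y (by simpa [mul_add, h3] using h2)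
    rw [mul_add, h3, h4, add_zero]
  · exact (hl _ _).2 (hsplit _ ((hl _ _).1 hy.1)).1
  · exact (Ideal.span_singleton_le_iff_mem _).2 ha
  · simpa [Ideal.span_singleton_eq_bot] using ha0
  · rw [Submodule.disjoint_def]
    rintro y hy ⟨hy', -⟩
    obtain ⟨z, rfl⟩ := Ideal.mem_span_singleton'.1 hy
    exact haa _ (hsplit _ ((hl _ _).1 hy')).2

/-- Were `B c` to miss a nonzero `K`, the chain `B cⁿ` would lose `K cⁿ` at each step. Since `B c`
is essential, any `x` with `c * x = 0` generates a nil left ideal, which is zero by semiprimeness.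
-/
theorem left_cancel_of_right_cancel {B : Type u} [Ring B] [IsNoetherianRing B]
    (hB : ∀ a : B, (∀ c, a * c * a = 0) → a = 0) {c : B} (hc : ∀ x, x * c = 0 → x = 0) :
    ∀ x, c * x = 0 → x = 0 := by
  have hcn : ∀ n : ℕ, ∀ x, x * c ^ n = 0 → x = 0 := fun n => by
    induction n with
    | zero => simp
    | succ n ih => intro x hx; rw [pow_succ, ← mul_assoc] at hx; exact ih x (hc _ hx)
  -- the left ideal `B c` is essential
  have hess : ∀ K : Ideal B, K ≠ ⊥ → ∃ x ∈ K, x ≠ 0 ∧ ∃ y, x = y * c := by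
    by_contra! h
    obtain ⟨K, hK, hKc⟩ := h
    have := wellFounded_iff_isEmpty_descending_chain.1 (wellFounded_not_essential B B)
    refine this.false ⟨fun n => Ideal.span {c ^ n}, fun n => ⟨?_,
      Submodule.map (LinearMap.toSpanSingleton B B (c ^ n)) K, ?_, ?_, ?_⟩⟩
    · rw [Ideal.span_singleton_le_iff_mem, pow_succ']
      exact Ideal.mul_mem_left _ _ (Ideal.subset_span rfl)
    · rintro _ ⟨x, _, rfl⟩
      exact Ideal.mul_mem_left _ _ (Ideal.subset_span rfl)
    · intro h
      refine hK (le_bot_iff.1 fun x hx => ?_)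
      have : x * c ^ n ∈ (⊥ : Ideal B) := h ▸ ⟨x, hx, by simp⟩
      exact hcn n x (by simpa using this)
    · rw [Submodule.disjoint_def]
      rintro _ ⟨x, hx, rfl⟩ hx'
      obtain ⟨y, hy⟩ := Ideal.mem_span_singleton'.1 hx'
      have h1 : x = y * c := sub_eq_zero.1 (hcn n _ (by
        rw [sub_mul, mul_assoc, ← pow_succ', hy]; simp))
      have : x = 0 := by
        by_contra hx0
        exact hKc x hx hx0 y h1
      simp [this]
  -- the elements killed by an essential left ideal form a nil left ideal
  intro x hx
  have hnil : ∀ y ∈ Ideal.span {x}, ∃ n : ℕ, y ^ n ∈ (⊥ : Ideal B) := by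
    intro y hy
    obtain ⟨b, rfl⟩ := Ideal.mem_span_singleton'.1 hy
    obtain ⟨n, hn⟩ := isNilpotent_of_essential_annihilator (b * x) fun K hK => by
      by_cases h : ∀ k ∈ K, k * b = 0
      · obtain ⟨k, hk, hk0⟩ := Submodule.exists_mem_ne_zero_of_ne_bot hK
        exact ⟨k, hk, hk0, by rw [← mul_assoc, h k hk, zero_mul]⟩
      · push Not at h
        obtain ⟨k, hk, hkb⟩ := h
        obtain ⟨z, ⟨m, hm, rfl⟩, hz0, w, hw⟩ := hess (Submodule.map (LinearMap.toSpanSingleton B B b) K)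
          fun h => hkb (by
            have : k * b ∈ (⊥ : Ideal B) := h ▸ ⟨k, hk, by simp⟩
            simpa using this)
        simp only [LinearMap.toSpanSingleton_apply, smul_eq_mul] at hz0 hw
        refine ⟨m, hm, fun h => hz0 (by rw [h, zero_mul]), ?_⟩
        rw [← mul_assoc, hw, mul_assoc, hx, mul_zero]
    exact ⟨n, by simpa using hn⟩
  have := le_of_nil_modulo ⊥ (by simpa using hB) _ hnil (Ideal.subset_span rfl : x ∈ Ideal.span {x})
  simpa using this

/-! ### Elements regular modulo a semiprime ideal and dense submodules -/

/-- The elements which are regular modulo `N`. -/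
def regularModulo {R : Type u} [Ring R] (N : Ideal R) : Set R :=
  {c | (∀ x, x * c ∈ N → x ∈ N) ∧ ∀ x, c * x ∈ N → x ∈ N}

theorem one_mem_regularModulo {R : Type u} [Ring R] (N : Ideal R) : 1 ∈ regularModulo N := by
  simp [regularModulo]

theorem mul_mem_regularModulo {R : Type u} [Ring R] {N : Ideal R} {c d : R}
    (hc : c ∈ regularModulo N) (hd : d ∈ regularModulo N) : c * d ∈ regularModulo N :=
  ⟨fun x hx => hc.1 x (hd.1 _ (by rwa [mul_assoc])), fun x hx => hd.2 x (hc.2 _ (by rwa [← mul_assoc]))⟩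

/-- Goldie's theorem in `R ⧸ N`, lifted to `R`: `hK` makes the image of `K` an essential left ideal.
-/
theorem exists_mem_regularModulo {R : Type u} [Ring R] [IsNoetherianRing R] (N : Ideal R)
    [N.IsTwoSided] (hN : ∀ a, (∀ c, a * c * a ∈ N) → a ∈ N) (K : Ideal R)
    (hK : ∀ L : Ideal R, N ≤ L → ¬ L ≤ N → ∃ x ∈ L, x ∈ K ∧ x ∉ N) :
    ∃ c ∈ K, c ∈ regularModulo N := by
  let π := Ideal.Quotient.mk N
  have hπ : Function.Surjective π := Ideal.Quotient.mk_surjective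
  have h0 : ∀ x, π x = 0 ↔ x ∈ N := fun x => Ideal.Quotient.eq_zero_iff_mem
  have : IsNoetherianRing (R ⧸ N) := isNoetherianRing_of_surjective _ _ π hπ
  have hB : ∀ a : R ⧸ N, (∀ c, a * c * a = 0) → a = 0 := by
    intro a ha
    obtain ⟨a, rfl⟩ := hπ a
    refine (h0 a).2 (hN a fun c => (h0 _).1 ?_)
    rw [map_mul, map_mul, ha]
  obtain ⟨c, hc, hcr⟩ := exists_right_cancel_mem_of_essential hB (I := K.map π) fun L hL h => by
    obtain ⟨y, hy, hy0⟩ := Submodule.exists_mem_ne_zero_of_ne_bot hL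
    obtain ⟨y, rfl⟩ := hπ y
    obtain ⟨x, hxL, hxK, hxN⟩ := hK (L.comap π) (fun x hx => by
      rw [Ideal.mem_comap, (h0 x).2 hx]; exact L.zero_mem)
      (fun h => hy0 ((h0 y).2 (h (Ideal.mem_comap.2 hy))))
    have : π x ∈ L ⊓ K.map π := ⟨hxL, Ideal.mem_map_of_mem π hxK⟩
    rw [h, Submodule.mem_bot] at this
    exact hxN ((h0 x).1 this)
  obtain ⟨c, hcK, rfl⟩ := (Ideal.mem_map_iff_of_surjective π hπ).1 hc
  refine ⟨c, hcK, fun x hx => (h0 x).1 (hcr _ ?_), fun x hx => (h0 x).1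
    (left_cancel_of_right_cancel hB hcr _ ?_)⟩
  · rw [← map_mul]; exact (h0 _).2 hx
  · rw [← map_mul]; exact (h0 _).2 hx

/-- Each element of `X` is moved by an element of `C` to an element of `X'`. -/
def Submodule.IsDenseIn {R : Type u} {M : Type v} [Ring R] [AddCommGroup M] [Module R M]
    (C : Set R) (X' X : Submodule R M) : Prop :=
  ∀ x ∈ X, ∃ c ∈ C, c • x ∈ X'

/-- When `N` kills the module, an essential submodule is dense: the conductor of each element into
it is essential modulo `N` and so contains a regular element. A non-dense step is thus a
non-essential one. -/
theorem wellFounded_not_isDenseIn {R : Type u} {M : Type v} [Ring R] [IsNoetherianRing R]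
    [AddCommGroup M] [Module R M] [IsNoetherian R M] (N : Ideal R) [N.IsTwoSided]
    (hN : ∀ a, (∀ c, a * c * a ∈ N) → a ∈ N) (hM : ∀ a ∈ N, ∀ m : M, a • m = 0) :
    WellFounded fun X' X : Submodule R M => X' ≤ X ∧ ¬ X'.IsDenseIn (regularModulo N) X := by
  refine Subrelation.wf (fun {X' X} h => ?_) (wellFounded_not_essential R M)
  obtain ⟨hle, h⟩ := h
  refine ⟨hle, ?_⟩
  unfold Submodule.IsDenseIn at h
  push Not at h
  obtain ⟨x, hx, h⟩ := h
  by_contra! hess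
  obtain ⟨c, hc, hcN⟩ := exists_mem_regularModulo N hN
    (X'.comap (LinearMap.toSpanSingleton R M x)) fun L hNL hL => by
      let f := LinearMap.toSpanSingleton R M x
      by_cases h0 : Submodule.map f L = ⊥
      · obtain ⟨y, hy, hyN⟩ := SetLike.not_le_iff_exists.1 hL
        refine ⟨y, hy, ?_, hyN⟩
        have : f y = 0 := by simpa [h0] using Submodule.mem_map_of_mem (f := f) hy
        change f y ∈ X'
        rw [this]; exact X'.zero_mem
      · have hd := hess (Submodule.map f L) (by
          rintro _ ⟨y, _, rfl⟩; exact X.smul_mem _ hx) h0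
        rw [Submodule.disjoint_def] at hd
        push Not at hd
        obtain ⟨_, ⟨y, hy, rfl⟩, hyX, hy0⟩ := hd
        exact ⟨y, hy, hyX, fun hyN => hy0 (hM y hyN x)⟩
  exact h c hcN hc

theorem eventually_isDenseIn_of_wellFounded {R : Type u} {M : Type v} [Ring R] [AddCommGroup M]
    [Module R M] {C : Set R}
    (hwf : WellFounded fun X' X : Submodule R M => X' ≤ X ∧ ¬ X'.IsDenseIn C X)
    (X : ℕ → Submodule R M) (hX : Antitone X) :
    ∃ n, ∀ m ≥ n, (X (m + 1)).IsDenseIn C (X m) := by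
  by_contra! h
  choose g hg hgX using h
  -- Each next bad index is sought strictly beyond the previous one, so the selected subchain has
  -- only non-dense steps.
  let s : ℕ → ℕ := fun n => Nat.rec (g 0) (fun _ m => g (m + 1)) n
  refine (wellFounded_iff_isEmpty_descending_chain.1 hwf).false ⟨fun n => X (s n), fun n => ?_⟩
  have hs : s n + 1 ≤ s (n + 1) := hg (s n + 1)
  refine ⟨hX (by omega), fun hd => ?_⟩
  have : ¬ (X (s n + 1)).IsDenseIn C (X (s n)) := by
    rcases n with _ | n
    · exact hgX 0
    · exact hgX (s n + 1)
  exact this fun x hx => (hd x hx).imp fun c hc => ⟨hc.1, hX hs hc.2⟩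

/-- Over a left Noetherian ring, in a descending chain of submodules of a Noetherian module all but
finitely many terms are dense in the preceding one with respect to the elements regular modulo a
nilpotent semiprime ideal. -/
theorem eventually_isDenseIn {R : Type u} [Ring R] [IsNoetherianRing R] (N : Ideal R)
    [N.IsTwoSided] (hN : ∀ a, (∀ c, a * c * a ∈ N) → a ∈ N) (hnil : IsNilpotent N)
    (M : Type v) [AddCommGroup M] [Module R M] [IsNoetherian R M]
    (X : ℕ → Submodule R M) (hX : Antitone X) :
    ∃ n, ∀ m ≥ n, (X (m + 1)).IsDenseIn (regularModulo N) (X m) := by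
  have main : ∀ (k : ℕ) (M : Type v) [AddCommGroup M] [Module R M] [IsNoetherian R M],
      (∀ a ∈ N ^ k, ∀ m : M, a • m = 0) → ∀ (X : ℕ → Submodule R M), Antitone X →
      ∃ n, ∀ m ≥ n, (X (m + 1)).IsDenseIn (regularModulo N) (X m) := by
    intro k
    induction k with
    | zero =>
      intro M _ _ _ h X _
      refine ⟨0, fun m _ x hx => ⟨1, one_mem_regularModulo N, ?_⟩⟩
      have : (1 : R) • x = 0 := h 1 (by rw [Submodule.pow_zero, Ideal.one_eq_top]; trivial) x
      rw [this]; exact Submodule.zero_mem _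
    | succ k ih =>
      intro M _ _ _ h X hX
      -- `N ^ k` kills `P` and `N` kills `M ⧸ P`. An element is first moved into `X (m + 1)` up to
      -- an error in `P`, and the error is then moved by the induction hypothesis.
      let P : Submodule R M := N • ⊤
      obtain ⟨n₁, hn₁⟩ := ih P (fun a ha m => by
        obtain ⟨m, hm⟩ := m
        ext
        change a • m = 0
        refine Submodule.smul_induction_on hm (fun r hr x _ => ?_) fun x y hx hy => ?_
        · rw [← mul_smul]
          exact h _ (by rw [Submodule.pow_succ]; exact Ideal.mul_mem_mul ha hr) x
        · rw [smul_add, hx, hy, add_zero])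
        (fun n => (X n).comap P.subtype) fun i j hij => Submodule.comap_mono (hX hij)
      obtain ⟨n₂, hn₂⟩ := eventually_isDenseIn_of_wellFounded
        (wellFounded_not_isDenseIn (M := M ⧸ P) N hN (fun a ha m => by
          obtain ⟨m, rfl⟩ := P.mkQ_surjective m
          rw [← map_smul, Submodule.mkQ_apply, Submodule.Quotient.mk_eq_zero]
          exact Submodule.smul_mem_smul ha trivial))
        (fun n => (X n).map P.mkQ) fun i j hij => Submodule.map_mono (hX hij)
      refine ⟨max n₁ n₂, fun m hm x hx => ?_⟩
      obtain ⟨c, hc, y, hy, hyx⟩ := hn₂ m (le_of_max_le_right hm) _ (Submodule.mem_map_of_mem hx)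
      have hP : c • x - y ∈ P := by
        rw [← Submodule.Quotient.mk_eq_zero, ← Submodule.mkQ_apply, map_sub, hyx, map_smul, sub_self]
      obtain ⟨d, hd, hdX⟩ := hn₁ m (le_of_max_le_left hm) ⟨c • x - y, hP⟩
        ((X m).sub_mem ((X m).smul_mem _ hx) (hX m.le_succ hy))
      refine ⟨d * c, mul_mem_regularModulo hd hc, ?_⟩
      have h1 : d • (c • x - y) ∈ X (m + 1) := hdX
      have h2 := (X (m + 1)).add_mem h1 ((X (m + 1)).smul_mem d hy)
      rwa [← smul_add, sub_add_cancel, ← mul_smul] at h2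
  obtain ⟨k, hk⟩ := hnil
  exact main k M (fun a ha m => by rw [hk] at ha; rw [(Submodule.mem_bot R).1 ha, zero_smul]) X hX

end Goldie

/-! ### A criterion for a ring to be semiprimary -/

section Semiprimary

universe u

/-- The right annihilator of a set. -/
def rightAnnihilator {Q : Type u} [Ring Q] (S : Set Q) : Set Q := {x | ∀ s ∈ S, s * x = 0}

theorem rightAnnihilator_anti {Q : Type u} [Ring Q] {S T : Set Q} (h : S ⊆ T) :
    rightAnnihilator T ⊆ rightAnnihilator S := fun _ hx s hs => hx s (h hs)

/-- A ring with ascending chain condition on right annihilators, in which elements with zero right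
annihilator are invertible, is semilocal. -/
theorem isSemisimpleRing_quotient_jacobson {Q : Type u} [Ring Q]
    (hunit : ∀ q : Q, (∀ x, q * x = 0 → x = 0) → IsUnit q)
    (hacc : WellFounded fun S T : Set Q => rightAnnihilator T ⊂ rightAnnihilator S) :
    IsSemisimpleRing (Q ⧸ Ring.jacobson Q) := by
  have key : ∀ I : Ideal Q, ∃ a ∈ I, ∀ b, b * (1 - a) ∈ I → b * (1 - a) ∈ Ring.jacobson Q := by
    intro I
    -- The right annihilator of `1 - a` is taken maximal; modulo the radical `1 - a` then generates
    -- a complement of `I`.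
    obtain ⟨_, ⟨a, ha, rfl⟩, hmax⟩ := hacc.has_min {S | ∃ a ∈ I, S = {1 - a}}
      ⟨_, 0, I.zero_mem, rfl⟩
    refine ⟨a, ha, ?_⟩
    have hu : ∀ b, b * (1 - a) ∈ I → IsUnit (1 - b * (1 - a)) := by
      intro b hb
      set c := 1 - a with hc
      -- The element `a + c * b * c` is again in `I`, and `1` minus it is `(1 - c * b) * c`, whose
      -- right annihilator contains that of `c`; maximality gives equality.
      have hsub : ∀ z, (1 - (a + c * (b * c))) * z = 0 → c * z = 0 := by
        intro z hz
        by_contra hcz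
        refine hmax {1 - (a + c * (b * c))} ⟨_, I.add_mem ha (I.mul_mem_left _ hb), rfl⟩
          ⟨fun w hw => ?_, fun h => hcz ?_⟩
        · have hw' : c * w = 0 := hw c rfl
          rintro _ rfl
          have : (1 - (a + c * (b * c))) * w = (1 - c * b) * (c * w) := by rw [hc]; noncomm_ring
          rw [this, hw', mul_zero]
        · exact h (fun s hs => by rw [Set.mem_singleton_iff.1 hs]; exact hz) c rfl
      have h1 : IsUnit (1 - c * b) := hunit _ fun y hy => by
        have hy' : y = c * (b * y) := by
          rw [sub_mul, one_mul, sub_eq_zero] at hy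
          rw [← mul_assoc]; exact hy
        rw [hy']
        refine hsub _ ?_
        have : (1 - (a + c * (b * c))) * (b * y) = (1 - c * b) * (c * (b * y)) := by
          rw [hc]; noncomm_ring
        rw [this, ← hy', hy]
      obtain ⟨u, hu⟩ := h1
      have h2 : (↑u⁻¹ : Q) * (1 - c * b) = 1 := by rw [← hu]; simp
      have h3 : (1 - c * b) * (↑u⁻¹ : Q) = 1 := by rw [← hu]; simp
      -- Jacobson's formula for the inverse of `1 - b * c` from that of `1 - c * b`.
      refine ⟨⟨1 - b * c, 1 + b * (↑u⁻¹ : Q) * c, ?_, ?_⟩, rfl⟩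
      · calc (1 - b * c) * (1 + b * (↑u⁻¹ : Q) * c)
            = 1 - b * c + b * ((1 - c * b) * (↑u⁻¹ : Q)) * c := by noncomm_ring
          _ = 1 := by rw [h3]; noncomm_ring
      · calc (1 + b * (↑u⁻¹ : Q) * c) * (1 - b * c)
            = 1 - b * c + b * ((↑u⁻¹ : Q) * (1 - c * b)) * c := by noncomm_ring
          _ = 1 := by rw [h2]; noncomm_ring
    intro b hb
    rw [← Ideal.jacobson_bot, Ideal.mem_jacobson_iff]
    intro y
    obtain ⟨u, hu⟩ := hu (-y * b) (by rw [mul_assoc]; exact I.mul_mem_left _ hb)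
    refine ⟨(↑u⁻¹ : Q), ?_⟩
    rw [Submodule.mem_bot, sub_eq_zero]
    calc (↑u⁻¹ : Q) * y * (b * (1 - a)) + ↑u⁻¹ = ↑u⁻¹ * (1 - -y * b * (1 - a)) := by noncomm_ring
      _ = 1 := by rw [← hu, Units.inv_mul]
  refine (isSemisimpleModule_iff _ _).2 ⟨fun I => ?_⟩
  let π := Ideal.Quotient.mk (Ring.jacobson Q)
  have hπ : Function.Surjective π := Ideal.Quotient.mk_surjective
  obtain ⟨a, ha, hI⟩ := key (Ideal.comap π I)
  refine ⟨Ideal.span {π (1 - a)}, ?_, ?_⟩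
  · rw [Submodule.disjoint_def]
    intro x hx hx'
    obtain ⟨y, rfl⟩ := Ideal.mem_span_singleton'.1 hx'
    obtain ⟨b, rfl⟩ := hπ y
    rw [← map_mul] at hx ⊢
    exact Ideal.Quotient.eq_zero_iff_mem.2 (hI b hx)
  · rw [codisjoint_iff, Ideal.eq_top_iff_one]
    have : (1 : Q ⧸ Ring.jacobson Q) = π a + π (1 - a) := by rw [← map_add]; simp
    rw [this]
    exact Submodule.add_mem_sup ha (Ideal.subset_span rfl)

/-- In a ring with both chain conditions on right annihilators, nil ideals are nilpotent. -/
theorem isNilpotent_of_nil {Q : Type u} [Ring Q]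
    (hacc : WellFounded fun S T : Set Q => rightAnnihilator T ⊂ rightAnnihilator S)
    (hdcc : WellFounded fun S T : Set Q => rightAnnihilator S ⊂ rightAnnihilator T)
    (J : Ideal Q) [J.IsTwoSided] (hJ : ∀ x ∈ J, IsNilpotent x) : IsNilpotent J := by
  by_contra hJn
  -- `P T` says that `T J ^ m ≠ 0` for all `m`. The two-sided `T` is taken with maximal right
  -- annihilator among those satisfying it.
  let P : Ideal Q → Prop := fun T => ∀ m : ℕ, ∃ t ∈ T, ∃ y ∈ J ^ m, t * y ≠ 0
  have hP : P ⊤ := fun m => by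
    by_contra! h
    exact hJn ⟨m, le_bot_iff.1 fun y hy => by simpa using h 1 trivial y hy⟩
  obtain ⟨_, ⟨T, hT, hPT, rfl⟩, hmax⟩ := hacc.has_min
    {S | ∃ T : Ideal Q, T.IsTwoSided ∧ P T ∧ S = T} ⟨_, ⊤, inferInstance, hP, rfl⟩
  -- `L m` consists of the `x` with `T x J ^ m = 0`. The right annihilators of `T (L m)` descend,
  -- and `L` is constant once they are.
  let L : ℕ → Ideal Q := fun m =>
    { carrier := {x | ∀ t ∈ T, ∀ y ∈ J ^ m, t * x * y = 0}
      add_mem' := fun {a b} ha hb t ht y hy => by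
        rw [mul_add, add_mul, ha t ht y hy, hb t ht y hy, add_zero]
      zero_mem' := fun t _ y _ => by simp
      smul_mem' := fun c x hx t ht y hy => by
        rw [smul_eq_mul, ← mul_assoc t]
        exact hx _ (T.mul_mem_right c ht) y hy }
  have hL : ∀ m x, x ∈ L m ↔ ∀ t ∈ T, ∀ y ∈ J ^ m, t * x * y = 0 := fun _ _ => Iff.rfl
  have hLts : ∀ m, (L m).IsTwoSided := fun m => ⟨fun {x} b hx t ht y hy => by
    rw [← mul_assoc, mul_assoc _ b]
    exact hx t ht _ ((J ^ m).mul_mem_left b hy)⟩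
  have hLmono : Monotone L := fun i j hij x hx t ht y hy => hx t ht y (Ideal.pow_le_pow_right hij hy)
  obtain ⟨m, hm⟩ : ∃ m, ∀ s, L s ≤ L m := by
    obtain ⟨_, ⟨m, rfl⟩, hmin⟩ := hdcc.has_min
      (Set.range fun m => {z | ∃ t ∈ T, ∃ x ∈ L m, z = t * x}) ⟨_, 0, rfl⟩
    refine ⟨m, fun s => ?_⟩
    rcases le_total s m with h | h
    · exact hLmono h
    intro x hx t ht y hy
    by_contra hne
    refine hmin _ ⟨s, rfl⟩ ⟨rightAnnihilator_anti ?_, fun h' => hne ?_⟩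
    · rintro _ ⟨t, ht, x, hx, rfl⟩
      exact ⟨t, ht, x, hLmono h hx, rfl⟩
    · have : y ∈ rightAnnihilator {z | ∃ t ∈ T, ∃ x ∈ L m, z = t * x} := by
        rintro _ ⟨t, ht, x, hx, rfl⟩
        exact hx t ht y hy
      exact h' this _ ⟨t, ht, x, hx, rfl⟩
  have := hLts m
  have hJL : ∃ a ∈ J, a ∉ L m := by
    by_contra! h
    obtain ⟨t, ht, y, hy, hne⟩ := hPT (m + 1)
    refine hne ?_
    rw [Ideal.IsTwoSided.pow_succ] at hy
    refine Submodule.smul_induction_on hy (fun j hj y hy => ?_) fun x y hx hy => ?_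
    · rw [smul_eq_mul, ← mul_assoc]
      exact h j hj t ht y hy
    · rw [mul_add, hx, hy, add_zero]
  -- Without a chain condition on left annihilators, the one modulo `L m` is measured by the right
  -- annihilator of `T {x | x a ∈ L m}`, whose minimality replaces maximality in Levitzki's trick.
  let D : Q → Set Q := fun a => {z | ∃ t ∈ T, ∃ x, x * a ∈ L m ∧ z = t * x}
  obtain ⟨_, ⟨a, ⟨haJ, haL⟩, rfl⟩, hmin⟩ := hdcc.has_min (D '' {a | a ∈ J ∧ a ∉ L m})
    (hJL.elim fun a ha => ⟨_, a, ha, rfl⟩)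
  have haa : ∀ c, a * c * a ∈ L m := by
    refine mul_mul_mem_of_maximal (L m) (fun r hr x hx => ?_) fun r => ?_
    · intro t ht y hy
      by_contra hne
      refine hmin _ ⟨a * r, ⟨J.mul_mem_right r haJ, hr⟩, rfl⟩
        ⟨rightAnnihilator_anti ?_, fun h' => hne ?_⟩
      · rintro _ ⟨t, ht, x, hx, rfl⟩
        exact ⟨t, ht, x, by simpa [mul_assoc] using (L m).mul_mem_right r hx, rfl⟩
      · have : a * y ∈ rightAnnihilator (D a) := by
          rintro _ ⟨t, ht, x, hx, rfl⟩
          have := hx t ht y hy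
          simpa only [mul_assoc] using this
        have := h' this _ ⟨t, ht, x, hx, rfl⟩
        simpa only [mul_assoc] using this
    · obtain ⟨n, hn⟩ := hJ _ (J.mul_mem_right r haJ)
      exact ⟨n, by rw [hn]; exact (L m).zero_mem⟩
  -- `a Q a ⊆ L m` means that `a J ^ m` is killed by `T' = T a Q`. Either `P T'` holds, and
  -- maximality of `T` gives `T a J ^ m = 0`, or `T' J ^ s = 0` for some `s`, and `a ∈ L s`; both
  -- contradict `a ∉ L m`.
  let T' : Ideal Q := Ideal.span {z | ∃ t ∈ T, ∃ q, z = t * a * q}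
  have hT'T : T' ≤ T := by
    rw [Ideal.span_le]
    rintro _ ⟨t, ht, q, rfl⟩
    exact T.mul_mem_right q (T.mul_mem_right a ht)
  have hT' : T'.IsTwoSided := ⟨fun {x} b hx => by
    induction hx using Submodule.span_induction with
    | mem x hx =>
      obtain ⟨t, ht, q, rfl⟩ := hx
      exact Ideal.subset_span ⟨t, ht, q * b, mul_assoc _ _ _⟩
    | zero => simp
    | add x y _ _ hx hy => rw [add_mul]; exact T'.add_mem hx hy
    | smul c x _ hx => rw [smul_mul_assoc]; exact T'.smul_mem _ hx⟩
  by_cases hPT' : P T'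
  · refine haL fun t ht y hy => ?_
    by_contra hne
    refine hmax _ ⟨T', hT', hPT', rfl⟩ ⟨rightAnnihilator_anti hT'T, fun h' => hne ?_⟩
    have : a * y ∈ rightAnnihilator (T' : Set Q) := by
      intro s hs
      induction hs using Submodule.span_induction with
      | mem s hs =>
        obtain ⟨t, ht, q, rfl⟩ := hs
        have := haa q t ht y hy
        simpa only [mul_assoc] using this
      | zero => simp
      | add x y _ _ hx hy => rw [add_mul, hx, hy, add_zero]
      | smul c x _ hx => rw [smul_mul_assoc, hx, smul_zero]
    rw [mul_assoc]
    exact h' this t ht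
  · simp only [P] at hPT'
    push Not at hPT'
    obtain ⟨s, hs⟩ := hPT'
    exact haL (hm s fun t ht y hy => hs _ (Ideal.subset_span ⟨t, ht, 1, (mul_one _).symm⟩) y hy)

theorem isSemiprimaryRing_of_rightAnnihilator {Q : Type u} [Ring Q]
    (hunit : ∀ q : Q, (∀ x, q * x = 0 → x = 0) → IsUnit q)
    (hacc : WellFounded fun S T : Set Q => rightAnnihilator T ⊂ rightAnnihilator S)
    (hdcc : WellFounded fun S T : Set Q => rightAnnihilator S ⊂ rightAnnihilator T)
    (hnil : ∀ x ∈ Ring.jacobson Q, IsNilpotent x) : IsSemiprimaryRing Q :=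
  ⟨isSemisimpleRing_quotient_jacobson hunit hacc, isNilpotent_of_nil hacc hdcc _ hnil⟩

end Semiprimary

/-! ### Quotient rings of right Noetherian rings -/

section QuotientRingProperties

universe u

namespace RightGabrielTopology

namespace QuotientRing

variable {R : Type u} [Ring R] {G : RightGabrielTopology R}

theorem mk_mul_of (f : G.PartialHom) {x : R} (hx : x ∈ f.1.domain) :
    mk f * of G x = of G (f.1 ⟨x, hx⟩) :=
  mk_eq_of_agree fun y h₁ _ => PartialHom.val_mul f y hx (PartialHom.mem_mul.1 h₁).choose_spec

/-- The right ideal of the elements `x` of `R` such that `q x` lies in `R`. -/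
def denominators (q : G.QuotientRing) : RightIdeal R where
  carrier := {x | ∃ a, q * of G x = of G a}
  add_mem' := fun ⟨a, ha⟩ ⟨b, hb⟩ => ⟨a + b, by rw [map_add, mul_add, ha, hb, map_add]⟩
  zero_mem' := ⟨0, by simp⟩
  smul_mem' := fun c x ⟨a, ha⟩ => ⟨a * c.unop, by
    rw [MulOpposite.smul_eq_mul_unop, map_mul, ← mul_assoc, ha, map_mul]⟩

theorem denominators_mem (q : G.QuotientRing) : denominators q ∈ G.carrier := by
  obtain ⟨f, rfl⟩ := mk_surjective q
  exact G.mem_of_le _ _ f.2 fun x hx => ⟨_, mk_mul_of f hx⟩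

theorem eq_zero_of_mul_of (hG : G.IsTorsionFree) {q : G.QuotientRing} {I : RightIdeal R}
    (hI : I ∈ G.carrier) (h : ∀ x ∈ I, q * of G x = 0) : q = 0 := by
  obtain ⟨f, rfl⟩ := mk_surjective q
  refine mk_eq_mk.2 ⟨_, G.inf_mem _ _ f.2 hI, fun x hx => ⟨hx.1, trivial, ?_⟩⟩
  refine of_injective G hG ?_
  rw [← mk_mul_of, h x hx.2]
  exact (map_zero (of G)).symm

theorem eq_of_mul_of (hG : G.IsTorsionFree) {p q : G.QuotientRing} {I : RightIdeal R}
    (hI : I ∈ G.carrier) (h : ∀ x ∈ I, p * of G x = q * of G x) : p = q :=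
  sub_eq_zero.1 (eq_zero_of_mul_of hG hI fun x hx => by rw [sub_mul, h x hx, sub_self])

/-- A homomorphism of right modules from a dense right ideal of the quotient ring to the quotient
ring, given by its graph `P`, is a left multiplication. -/
theorem exists_mul_eq (hG : G.IsTorsionFree) (P : G.QuotientRing → G.QuotientRing → Prop)
    (hadd : ∀ x z x' z', P x z → P x' z' → P (x + x') (z + z'))
    (hmul : ∀ x z r, P x z → P (x * r) (z * r)) (hzero : ∀ z, P 0 z → z = 0)
    {I : RightIdeal R} (hI : I ∈ G.carrier) (hP : ∀ a ∈ I, ∃ z, P (of G a) z) :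
    ∃ e, ∀ x z, P x z → e * x = z := by
  have hP0 : P 0 0 := by
    obtain ⟨z, hz⟩ := hP 0 I.zero_mem
    rw [map_zero] at hz
    rwa [hzero z hz] at hz
  -- The part of the graph lying in `R × R` is the graph of a partial homomorphism, whose class is
  -- the required multiplier.
  let Γ : Submodule Rᵐᵒᵖ (R × R) :=
    { carrier := {p | P (of G p.1) (of G p.2)}
      add_mem' := fun {p q} hp hq => by
        change P (of G (p.1 + q.1)) (of G (p.2 + q.2))
        rw [map_add, map_add]
        exact hadd _ _ _ _ hp hq
      zero_mem' := by
        change P (of G 0) (of G 0)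
        rwa [map_zero]
      smul_mem' := fun c p hp => by
        change P (of G (p.1 * c.unop)) (of G (p.2 * c.unop))
        rw [map_mul, map_mul]
        exact hmul _ _ _ hp }
  have hΓ0 : ∀ p ∈ Γ, p.1 = 0 → p.2 = 0 := fun p hp h0 => by
    have hp' : P (of G p.1) (of G p.2) := hp
    rw [h0, map_zero] at hp'
    exact of_injective G hG ((hzero _ hp').trans (map_zero _).symm)
  have hdom : Γ.toLinearPMap.domain ∈ G.carrier := by
    refine G.mem_of_colon_mem _ _ hI fun a ha => ?_
    obtain ⟨z, hz⟩ := hP a ha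
    refine G.mem_of_le _ _ (denominators_mem z) fun r ⟨b, hb⟩ => ?_
    refine ⟨(a * r, b), ?_, rfl⟩
    change P (of G (a * r)) (of G b)
    rw [map_mul, ← hb]
    exact hmul _ _ _ hz
  let f : G.PartialHom := ⟨Γ.toLinearPMap, hdom⟩
  have hf : ∀ a b, P (of G a) (of G b) → mk f * of G a = of G b := fun a b hab => by
    have hmem : (a, b) ∈ Γ.toLinearPMap.graph := by
      rw [Submodule.toLinearPMap_graph_eq _ hΓ0]
      exact hab
    obtain ⟨x, hx, hxb⟩ := (LinearPMap.mem_graph_iff _).1 hmem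
    obtain ⟨x, hxd⟩ := x
    obtain rfl : x = a := hx
    rw [mk_mul_of f hxd]
    exact congrArg _ hxb
  refine ⟨mk f, fun x z hxz => ?_⟩
  refine eq_of_mul_of hG (G.inf_mem _ _ (denominators_mem x) (denominators_mem z)) fun r hr => ?_
  obtain ⟨⟨a, ha⟩, b, hb⟩ := hr
  rw [mul_assoc, ha, hb]
  refine hf a b ?_
  rw [← ha, ← hb]
  exact hmul _ _ _ hxz

/-- The contraction to `R` of the right annihilator of a subset of the quotient ring. -/
def annihilatorContraction (S : Set G.QuotientRing) : RightIdeal R where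
  carrier := {a | ∀ s ∈ S, s * of G a = 0}
  add_mem' := fun ha hb s hs => by rw [map_add, mul_add, ha s hs, hb s hs, add_zero]
  zero_mem' := fun s _ => by simp
  smul_mem' := fun c x hx s hs => by
    rw [MulOpposite.smul_eq_mul_unop, map_mul, ← mul_assoc, hx s hs, zero_mul]

/-- Denominators bring elements of a right annihilator down to `R`, and torsionfreeness brings the
vanishing back. Chain conditions on right annihilators thus reduce to chains of right ideals of `R`,
up to density. -/
theorem rightAnnihilator_subset (hG : G.IsTorsionFree) {S T : Set G.QuotientRing}
    (h : ∀ a ∈ annihilatorContraction S, (annihilatorContraction T).colon a ∈ G.carrier) :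
    rightAnnihilator S ⊆ rightAnnihilator T := by
  intro x hx t ht
  refine eq_zero_of_mul_of hG (denominators_mem x) fun r ⟨a, ha⟩ => ?_
  rw [mul_assoc, ha]
  refine eq_zero_of_mul_of hG (h a fun s hs => ?_) fun y hy => ?_
  · rw [← ha, ← mul_assoc, hx s hs, zero_mul]
  · rw [mul_assoc, ← map_mul]
    exact hy t ht

theorem annihilatorContraction_mono {S T : Set G.QuotientRing}
    (h : rightAnnihilator S ⊆ rightAnnihilator T) :
    annihilatorContraction S ≤ annihilatorContraction T := fun _ hx => h hx

theorem rightAnnihilator_acc [IsNoetherian Rᵐᵒᵖ R] (hG : G.IsTorsionFree) :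
    WellFounded fun S T : Set G.QuotientRing => rightAnnihilator T ⊂ rightAnnihilator S := by
  refine Subrelation.wf (fun {S T} h => ?_) (InvImage.wf annihilatorContraction
    (wellFounded_gt (α := RightIdeal R)))
  refine lt_of_le_not_ge (annihilatorContraction_mono h.1) fun hle => h.2 ?_
  refine rightAnnihilator_subset hG fun a ha => G.mem_of_le _ _ G.top_mem fun r _ => ?_
  exact (annihilatorContraction T).smul_mem (MulOpposite.op r) (hle ha)

variable (G) in
/-- In each descending chain of right ideals there is a term which is dense in the preceding one. -/
def _root_.RightGabrielTopology.HasDenseChains : Prop :=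
  ∀ X : ℕ → RightIdeal R, Antitone X → ∃ n, ∀ x ∈ X n, (X (n + 1)).colon x ∈ G.carrier

theorem rightAnnihilator_dcc (hG : G.IsTorsionFree) (hch : G.HasDenseChains) :
    WellFounded fun S T : Set G.QuotientRing => rightAnnihilator S ⊂ rightAnnihilator T := by
  rw [wellFounded_iff_isEmpty_descending_chain]
  refine ⟨fun ⟨S, hS⟩ => ?_⟩
  obtain ⟨n, hn⟩ := hch (fun n => annihilatorContraction (S n))
    (antitone_nat_of_succ_le fun n => annihilatorContraction_mono (hS n).1)
  exact (hS n).2 (rightAnnihilator_subset hG hn)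

/-- The contraction to `R` of the right ideal generated by an element. -/
def principalContraction (q : G.QuotientRing) : RightIdeal R where
  carrier := {a | ∃ y, of G a = q * y}
  add_mem' := fun ⟨y, hy⟩ ⟨z, hz⟩ => ⟨y + z, by rw [map_add, mul_add, hy, hz]⟩
  zero_mem' := ⟨0, by simp⟩
  smul_mem' := fun c x ⟨y, hy⟩ => ⟨y * of G c.unop, by
    rw [MulOpposite.smul_eq_mul_unop, map_mul, ← mul_assoc, hy]⟩

/-- Some right ideal from the topology is mapped by `q ^ n` to `q ^ (n + 1) Q`. -/
theorem exists_pow_mul_of_eq (hch : G.HasDenseChains) (q : G.QuotientRing) :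
    ∃ n : ℕ, ∃ I ∈ G.carrier, ∀ a ∈ I, ∃ y, q ^ n * of G a = q ^ (n + 1) * y := by
  obtain ⟨n, hn⟩ := hch (fun n => principalContraction (q ^ n))
    (antitone_nat_of_succ_le fun n a ⟨y, hy⟩ => ⟨q * y, by rw [hy, pow_succ, mul_assoc]⟩)
  let I : RightIdeal R :=
    { carrier := {a | ∃ y, q ^ n * of G a = q ^ (n + 1) * y}
      add_mem' := fun ⟨y, hy⟩ ⟨z, hz⟩ => ⟨y + z, by rw [map_add, mul_add, mul_add, hy, hz]⟩
      zero_mem' := ⟨0, by simp⟩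
      smul_mem' := fun c x ⟨y, hy⟩ => ⟨y * of G c.unop, by
        rw [MulOpposite.smul_eq_mul_unop, map_mul, ← mul_assoc, hy, mul_assoc]⟩ }
  refine ⟨n, I, G.mem_of_colon_mem _ _ (denominators_mem (q ^ n)) fun a ⟨b, hb⟩ => ?_,
    fun a ha => ha⟩
  refine G.mem_of_le _ _ (hn b ⟨of G a, hb.symm⟩) fun r ⟨y, hy⟩ => ⟨y, ?_⟩
  rw [← hy]
  change q ^ n * of G (a * r) = of G (b * r)
  rw [map_mul, map_mul, ← mul_assoc, hb]

/-- The chain `qⁿQ ∩ R` becomes dense; cancelling `qⁿ` puts a right ideal from the topology inside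
`qQ`. There `q * z ↦ z` is right linear, hence a left multiplication by some `p`. -/
theorem isUnit_of_left_cancel (hG : G.IsTorsionFree) (hch : G.HasDenseChains)
    {q : G.QuotientRing} (hq : ∀ x, q * x = 0 → x = 0) : IsUnit q := by
  obtain ⟨n, I, hI, hn⟩ := exists_pow_mul_of_eq hch q
  have hqn : ∀ n : ℕ, ∀ x, q ^ n * x = 0 → x = 0 := fun n => by
    induction n with
    | zero => simp
    | succ n ih => intro x hx; rw [pow_succ, mul_assoc] at hx; exact hq _ (ih _ hx)
  have hI' : ∀ a ∈ I, ∃ z, of G a = q * z := fun a ha => by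
    obtain ⟨y, hy⟩ := hn a ha
    refine ⟨y, sub_eq_zero.1 (hqn n _ ?_)⟩
    rw [mul_sub, hy, pow_succ, mul_assoc, sub_self]
  obtain ⟨p, hp⟩ := exists_mul_eq hG (fun x z => x = q * z)
    (fun x z x' z' h h' => by rw [h, h', mul_add]) (fun x z r h => by rw [h, mul_assoc])
    (fun z h => hq z h.symm) hI hI'
  have hpq : p * q = 1 := by simpa using hp (q * 1) 1 rfl
  refine ⟨⟨q, p, eq_of_mul_of hG hI fun a ha => ?_, hpq⟩, rfl⟩
  obtain ⟨z, hz⟩ := hI' a ha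
  rw [hz, mul_assoc, ← mul_assoc p, hpq, one_mul, one_mul]

/-- A left inverse `z` of `1 - w` equals `1 + z * w`, so it has a left inverse itself. -/
theorem _root_.Ring.isUnit_one_sub_of_mem_jacobson {Q : Type u} [Ring Q] {w : Q}
    (hw : w ∈ Ring.jacobson Q) : IsUnit (1 - w) := by
  have key : ∀ w ∈ Ring.jacobson Q, ∃ z, z * (1 - w) = 1 := fun w hw => by
    rw [← Ideal.jacobson_bot, Ideal.mem_jacobson_iff] at hw
    obtain ⟨z, hz⟩ := hw (-1)
    refine ⟨z, ?_⟩
    rw [Submodule.mem_bot, sub_eq_zero] at hz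
    exact (by noncomm_ring : z * (1 - w) = z * -1 * w + z).trans hz
  obtain ⟨z, hz⟩ := key w hw
  obtain ⟨t, ht⟩ := key (-(z * w)) ((Ring.jacobson Q).neg_mem ((Ring.jacobson Q).mul_mem_left _ hw))
  have hz' : 1 - -(z * w) = z := by rw [← hz]; noncomm_ring
  rw [hz'] at ht
  have h1 : t = 1 - w := by
    calc t = t * (z * (1 - w)) := by rw [hz, mul_one]
      _ = 1 - w := by rw [← mul_assoc, ht, one_mul]
  exact ⟨⟨1 - w, z, by rw [← h1, ht], hz⟩, rfl⟩

/-- A power `d` of `j` has the same right annihilator as its own powers, and `d` maps a dense right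
ideal into `d²Q`. This produces `e` with `d * e = d` and `d + 1 - e` invertible. As `d` is in the
radical, `1 - e` is invertible too, so `d = 0`. -/
theorem isNilpotent_of_mem_jacobson [IsNoetherian Rᵐᵒᵖ R] (hG : G.IsTorsionFree)
    (hch : G.HasDenseChains) {j : G.QuotientRing} (hj : j ∈ Ring.jacobson G.QuotientRing) :
    IsNilpotent j := by
  obtain ⟨_, ⟨n₀, rfl⟩, hmax⟩ := (rightAnnihilator_acc hG).has_min
    (Set.range fun n : ℕ => {j ^ (n + 1)}) ⟨_, 0, rfl⟩
  set d := j ^ (n₀ + 1) with hd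
  have hdJ : d ∈ Ring.jacobson G.QuotientRing := Ideal.pow_mem_of_mem _ hj _ n₀.succ_pos
  have hdn : ∀ n : ℕ, ∀ x, d ^ n * x = 0 → d * x = 0 := by
    intro n x hx
    rcases n with _ | n
    · rw [show x = 0 by simpa using hx, mul_zero]
    by_contra hne
    -- The family consists of the powers `j ^ (i + 1)`, so the exponent of `d ^ (n + 1)` enters
    -- reduced by one.
    refine hmax _ ⟨(n₀ + 1) * (n + 1) - 1, rfl⟩ ?_
    have hpow : j ^ ((n₀ + 1) * (n + 1) - 1 + 1) = d ^ (n + 1) := by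
      rw [Nat.sub_add_cancel (Nat.mul_pos n₀.succ_pos n.succ_pos), pow_mul]
    change rightAnnihilator {d} ⊂ rightAnnihilator {j ^ ((n₀ + 1) * (n + 1) - 1 + 1)}
    rw [hpow]
    refine ⟨fun y hy s hs => ?_, fun h => hne (h (fun s hs => ?_) d rfl)⟩
    · rw [Set.mem_singleton_iff.1 hs, pow_succ, mul_assoc, hy d rfl, mul_zero]
    · rw [Set.mem_singleton_iff.1 hs, hx]
  obtain ⟨n, I, hI, hn⟩ := exists_pow_mul_of_eq hch d
  have hI' : ∀ a ∈ I, ∃ y, d * of G a = d * (d * y) := fun a ha => by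
    obtain ⟨y, hy⟩ := hn a ha
    refine ⟨y, sub_eq_zero.1 ?_⟩
    rw [← mul_sub]
    refine hdn n _ ?_
    rw [mul_sub, hy, pow_succ, mul_assoc, sub_self]
  have hdd : ∀ x, d * (d * x) = 0 → d * x = 0 := fun x hx => hdn 2 x (by
    rw [pow_two, mul_assoc, hx])
  -- `e` sends `x` to `d * y` whenever `d * x = d * d * y`; this is single-valued because `d` and `d
  -- * d` have equal right annihilators.
  obtain ⟨e, he⟩ := exists_mul_eq hG (fun x z => ∃ y, d * x = d * (d * y) ∧ z = d * y)
    (fun x z x' z' ⟨y, h₁, h₂⟩ ⟨y', h₁', h₂'⟩ => ⟨y + y', by simp only [mul_add, h₁, h₁'],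
      by simp only [mul_add, h₂, h₂']⟩)
    (fun x z r ⟨y, h₁, h₂⟩ => ⟨y * r, by simp only [← mul_assoc] at h₁ ⊢; rw [h₁],
      by rw [h₂, mul_assoc]⟩)
    (fun z ⟨y, h₁, h₂⟩ => by
      rw [h₂]
      exact hdd y (by rw [← h₁, mul_zero]))
    hI (fun a ha => (hI' a ha).elim fun y hy => ⟨d * y, y, hy, rfl⟩)
  have hde : d * e = d := eq_of_mul_of hG hI fun a ha => by
    obtain ⟨y, hy⟩ := hI' a ha
    rw [mul_assoc, he _ _ ⟨y, hy, rfl⟩, hy]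
  obtain ⟨u, hu⟩ := isUnit_of_left_cancel hG hch (q := d + 1 - e) fun z hz => by
    have h1 : d * (d * z) = 0 := by
      have h2 : d * (d + 1 - e) = d * d := by rw [mul_sub, mul_add, hde, mul_one, add_sub_cancel_right]
      rw [← mul_assoc, ← h2, mul_assoc, hz, mul_zero]
    have h3 : d * z = 0 := hdd z h1
    have h4 : e * z = 0 := by
      simpa using he z _ ⟨0, by simpa using h3, rfl⟩
    simpa [sub_mul, add_mul, h3, h4] using hz
  have h1 : IsUnit (1 - e) := by
    have h2 : 1 - e = u * (1 - ↑u⁻¹ * d) := by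
      rw [mul_sub, mul_one, Units.mul_inv_cancel_left, hu]
      abel
    rw [h2]
    exact u.isUnit.mul (Ring.isUnit_one_sub_of_mem_jacobson (Ideal.mul_mem_left _ _ hdJ))
  have h2 : d * (1 - e) = 0 := by rw [mul_sub, hde, mul_one, sub_self]
  exact ⟨n₀ + 1, (h1.mul_left_eq_zero).1 h2⟩

theorem isSemiprimaryRing [IsNoetherian Rᵐᵒᵖ R] (hG : G.IsTorsionFree) (hch : G.HasDenseChains) :
    IsSemiprimaryRing G.QuotientRing :=
  isSemiprimaryRing_of_rightAnnihilator (fun _ => isUnit_of_left_cancel hG hch)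
    (rightAnnihilator_acc hG) (rightAnnihilator_dcc hG hch)
    fun _ => isNilpotent_of_mem_jacobson hG hch

end QuotientRing

end RightGabrielTopology

end QuotientRingProperties

/-! ### Comatrices in Hopf algebras -/

section Comatrices

universe u v w

open TensorProduct Coalgebra HopfAlgebra

/-- A square matrix over a coalgebra whose entries are comultiplied as matrix coordinates. -/
structure IsComatrix (k : Type u) {H : Type v} {ι : Type*} [Field k] [AddCommGroup H] [Module k H]
    [Coalgebra k H] [Fintype ι] [DecidableEq ι] (e : Matrix ι ι H) : Prop where
  comul_eq : ∀ i j, comul (R := k) (e i j) = ∑ l, e i l ⊗ₜ[k] e l j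
  counit_eq : ∀ i j, counit (R := k) (e i j) = if i = j then 1 else 0

/-! ### Local finiteness of coalgebras -/

section Coalgebra

variable {k : Type u} {H : Type v} [Field k] [AddCommGroup H] [Module k H] [Coalgebra k H]

/-- The left action of the dual space of a coalgebra. -/
def dualHit (η : Module.Dual k H) : H →ₗ[k] H :=
  (TensorProduct.rid k H).toLinearMap ∘ₗ η.lTensor H ∘ₗ comul

/-- Coassociativity: the dual space acts through convolution, so the orbit of an element is stable.
-/
theorem dualHit_dualHit (η ξ : Module.Dual k H) (h : H) :
    dualHit η (dualHit ξ h) = dualHit (LinearMap.mul' k k ∘ₗ TensorProduct.map η ξ ∘ₗ comul) h := by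
  have key : ∀ t : H ⊗[k] H, dualHit η (TensorProduct.rid k H (ξ.lTensor H t)) =
      TensorProduct.rid k H ((LinearMap.mul' k k ∘ₗ TensorProduct.map η ξ).lTensor H
        (TensorProduct.assoc k H H H (comul.rTensor H t))) := by
    intro t
    induction t with
    | zero => simp
    | add x y hx hy => simp only [map_add, hx, hy]
    | tmul x y =>
      simp only [LinearMap.lTensor_tmul, TensorProduct.rid_tmul, map_smul, LinearMap.rTensor_tmul,
        dualHit, LinearMap.comp_apply, LinearEquiv.coe_coe]
      generalize comul (R := k) x = s
      induction s with
      | zero => simp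
      | add x y hx hy => simp only [map_add, smul_add, hx, hy, TensorProduct.add_tmul]
      | tmul a b => simp [smul_smul, mul_comm]
  have h1 := key (comul h)
  rw [coassoc_apply] at h1
  refine h1.trans ?_
  change _ = TensorProduct.rid k H (LinearMap.lTensor H
    ((LinearMap.mul' k k ∘ₗ TensorProduct.map η ξ) ∘ₗ comul) (comul h))
  simp only [LinearMap.lTensor_comp, LinearMap.comp_apply]

theorem TensorProduct.eq_of_lTensor_dual {M N : Type*} [AddCommGroup M] [Module k M]
    [AddCommGroup N] [Module k N] {s t : M ⊗[k] N}
    (h : ∀ η : Module.Dual k N, TensorProduct.rid k M (η.lTensor M s) =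
      TensorProduct.rid k M (η.lTensor M t)) : s = t := by
  classical
  let b := Module.Basis.ofVectorSpace k N
  refine (TensorProduct.equivFinsuppOfBasisRight (M := M) b).injective (Finsupp.ext fun i => ?_)
  have key : ∀ s : M ⊗[k] N, TensorProduct.equivFinsuppOfBasisRight (M := M) b s i =
      TensorProduct.rid k M ((b.coord i).lTensor M s) := by
    intro s
    induction s with
    | zero => simp
    | add x y hx hy => simp only [map_add, Finsupp.add_apply, hx, hy]
    | tmul x y => simp
  rw [key, key, h]

/-- Each element of a coalgebra is a linear combination of the entries of a comatrix. -/
theorem exists_isComatrix (h : H) : ∃ (n : ℕ) (e : Matrix (Fin n) (Fin n) H), IsComatrix k e ∧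
    h ∈ Submodule.span k (Set.range fun p : Fin n × Fin n => e p.1 p.2) := by
  classical
  let φ : Module.Dual k H →ₗ[k] H :=
    { toFun := fun ξ => dualHit ξ h
      map_add' := fun ξ η => by simp [dualHit, LinearMap.lTensor_add]
      map_smul' := fun c ξ => by simp [dualHit, LinearMap.lTensor_smul] }
  -- `V` is a finite-dimensional subcomodule containing `h`, that is `Δ(V) ⊆ V ⊗ H`; the comatrix is
  -- formed by its matrix coefficients.
  let V : Submodule k H := LinearMap.range φ
  have hhV : h ∈ V := ⟨counit, by simp [φ, dualHit]⟩
  have hstab : ∀ η : Module.Dual k H, ∀ x ∈ V, dualHit η x ∈ V := by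
    rintro η _ ⟨ξ, rfl⟩
    exact ⟨LinearMap.mul' k k ∘ₗ TensorProduct.map η ξ ∘ₗ comul, (dualHit_dualHit η ξ h).symm⟩
  have hfin : Module.Finite k V := by
    obtain ⟨S, hS⟩ := TensorProduct.exists_finset (R := k) (comul (R := k) h)
    have hle : V ≤ Submodule.span k (S.image Prod.fst : Finset H) := by
      rintro _ ⟨ξ, rfl⟩
      have : φ ξ = ∑ p ∈ S, ξ p.2 • p.1 := by simp [φ, dualHit, hS]
      rw [this]
      refine Submodule.sum_mem _ fun p hp => Submodule.smul_mem _ _ (Submodule.subset_span ?_)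
      exact Finset.mem_coe.2 (Finset.mem_image_of_mem _ hp)
    exact Submodule.finiteDimensional_of_le hle
  let b := Module.finBasis k V
  have hsum : ∀ x : V, ∑ i, b.repr x i • (b i : H) = x := fun x => by
    conv_rhs => rw [← b.sum_repr x]
    simp only [Submodule.coe_sum, Submodule.coe_smul]
  -- A projection onto `V` extends the coordinate functions of `V` to `H`.
  obtain ⟨p, hp⟩ := V.subtype.exists_leftInverse_of_injective V.ker_subtype
  have hpV : ∀ x : V, p x = x := fun x => LinearMap.congr_fun hp x
  let c : Fin (Module.finrank k V) → Module.Dual k H := fun i => b.coord i ∘ₗ p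
  have hc : ∀ i j, c i (b j) = if i = j then 1 else 0 := fun i j => by
    simp [c, hpV, Finsupp.single_apply, eq_comm]
  let e : Matrix (Fin (Module.finrank k V)) (Fin (Module.finrank k V)) H := fun i j =>
    TensorProduct.lid k H ((c i).rTensor H (comul (b j : H)))
  have he : ∀ j, comul (R := k) (b j : H) = ∑ i, (b i : H) ⊗ₜ[k] e i j := by
    intro j
    have h1 : (V.subtype ∘ₗ p).rTensor H (comul (R := k) (b j : H)) = comul (R := k) (b j : H) := by
      refine TensorProduct.eq_of_lTensor_dual fun η => ?_
      have h2 : ∀ t : H ⊗[k] H, TensorProduct.rid k H (η.lTensor H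
          ((V.subtype ∘ₗ p).rTensor H t)) =
          (V.subtype ∘ₗ p) (TensorProduct.rid k H (η.lTensor H t)) := by
        intro t
        induction t with
        | zero => simp
        | add x y hx hy => simp only [map_add, hx, hy]
        | tmul x y => simp
      rw [h2]
      have h3 := hpV ⟨_, hstab η _ (b j).2⟩
      exact congrArg Subtype.val h3
    have h4 : ∀ t : H ⊗[k] H, (V.subtype ∘ₗ p).rTensor H t =
        ∑ i, (b i : H) ⊗ₜ[k] TensorProduct.lid k H ((c i).rTensor H t) := by
      intro t
      induction t with
      | zero => simp
      | add x y hx hy => simp only [map_add, hx, hy, TensorProduct.tmul_add, Finset.sum_add_distrib]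
      | tmul x y =>
        simp only [LinearMap.rTensor_tmul, TensorProduct.lid_tmul, TensorProduct.tmul_smul,
          TensorProduct.smul_tmul', ← TensorProduct.sum_tmul]
        congr 1
        exact (hsum (p x)).symm
    rw [← h1, h4]
  refine ⟨_, e, ⟨fun i j => ?_, fun i j => ?_⟩, ?_⟩
  · have h1 : ∀ t : H ⊗[k] H, comul (R := k) (TensorProduct.lid k H ((c i).rTensor H t)) =
        TensorProduct.lid k (H ⊗[k] H) ((c i).rTensor (H ⊗[k] H) (comul.lTensor H t)) := by
      intro t
      induction t with
      | zero => simp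
      | add x y hx hy => simp only [map_add, hx, hy]
      | tmul x y => simp
    change comul (R := k) (TensorProduct.lid k H ((c i).rTensor H (comul (b j : H)))) = _
    rw [h1, ← coassoc_apply, he j]
    simp only [map_sum, LinearMap.rTensor_tmul, he, TensorProduct.sum_tmul,
      TensorProduct.assoc_tmul, TensorProduct.lid_tmul, hc, ite_smul, one_smul, zero_smul,
      Finset.sum_ite_eq, Finset.mem_univ, if_true]
  · have h1 : ∀ t : H ⊗[k] H, counit (R := k) (TensorProduct.lid k H ((c i).rTensor H t)) =
        c i (TensorProduct.rid k H (counit.lTensor H t)) := by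
      intro t
      induction t with
      | zero => simp
      | add x y hx hy => simp only [map_add, hx, hy]
      | tmul x y => simp [mul_comm]
    change counit (R := k) (TensorProduct.lid k H ((c i).rTensor H (comul (b j : H)))) = _
    rw [h1, lTensor_counit_comul, TensorProduct.rid_tmul, one_smul, hc]
  -- The counit on the first factor of `Δ(b j)` expresses the basis, hence `h`, through the
  -- coefficients.
  · have hb : ∀ j, (b j : H) = ∑ i, counit (R := k) (b i : H) • e i j := fun j => by
      have h1 := congrArg (fun t => TensorProduct.lid k H (counit.rTensor H t)) (he j)
      simpa using h1
    have h1 : h = ∑ j, (b.repr ⟨h, hhV⟩ j) • (b j : H) := by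
      exact (hsum ⟨h, hhV⟩).symm
    rw [h1]
    refine Submodule.sum_mem _ fun j _ => Submodule.smul_mem _ _ ?_
    rw [hb j]
    exact Submodule.sum_mem _ fun i _ => Submodule.smul_mem _ _ (Submodule.subset_span ⟨(i, j), rfl⟩)

theorem forall_of_isComatrix {P : H → Prop} (hadd : ∀ x y, P x → P y → P (x + y)) (hzero : P 0)
    (hsmul : ∀ (c : k) x, P x → P (c • x))
    (hP : ∀ (n : ℕ) (e : Matrix (Fin n) (Fin n) H), IsComatrix k e → ∀ i j, P (e i j)) (h : H) :
    P h := by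
  obtain ⟨n, e, he, hh⟩ := exists_isComatrix (k := k) h
  induction hh using Submodule.span_induction with
  | mem x hx => obtain ⟨p, rfl⟩ := hx; exact hP n e he _ _
  | zero => exact hzero
  | add x y _ _ hx hy => exact hadd x y hx hy
  | smul c x _ hx => exact hsmul c x hx

end Coalgebra

/-! ### Products and antipodes of comatrices -/

namespace IsComatrix

variable {k : Type u} {H : Type v} [Field k] [Ring H] [HopfAlgebra k H]
  {ι κ : Type*} [Fintype ι] [DecidableEq ι] [Fintype κ] [DecidableEq κ]
  {e : Matrix ι ι H} {f : Matrix κ κ H}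

theorem mul (he : IsComatrix k e) (hf : IsComatrix k f) :
    IsComatrix k (Matrix.of fun p q : ι × κ => e p.1 q.1 * f p.2 q.2) where
  comul_eq p q := by
    simp only [Matrix.of_apply, Bialgebra.comul_mul, he.comul_eq, hf.comul_eq, Finset.sum_mul_sum,
      Algebra.TensorProduct.tmul_mul_tmul, Fintype.sum_prod_type]
  counit_eq p q := by
    simp only [Matrix.of_apply, Bialgebra.counit_mul, he.counit_eq, hf.counit_eq, Prod.ext_iff]
    split_ifs <;> simp_all

theorem sum_antipode_mul (he : IsComatrix k e) (i j : ι) :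
    ∑ l, antipode k (e i l) * e l j = if i = j then 1 else 0 := by
  have := mul_antipode_rTensor_comul_apply (R := k) (e i j)
  rw [he.comul_eq, he.counit_eq] at this
  simpa [apply_ite (algebraMap k H)] using this

theorem sum_mul_antipode (he : IsComatrix k e) (i j : ι) :
    ∑ l, e i l * antipode k (e l j) = if i = j then 1 else 0 := by
  have := mul_antipode_lTensor_comul_apply (R := k) (e i j)
  rw [he.comul_eq, he.counit_eq] at this
  simpa [apply_ite (algebraMap k H)] using this

/-- Both sides, as matrices over `H ⊗ H`, are inverse to the matrix of the `Δ(e i j)`, one on the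
left and one on the right, so they coincide. -/
theorem comul_antipode (he : IsComatrix k e) (i j : ι) :
    comul (R := k) (antipode k (e i j)) =
      ∑ l, antipode k (e l j) ⊗ₜ[k] antipode k (e i l) := by
  let Δ := Bialgebra.comulAlgHom k H
  let M : Matrix ι ι (H ⊗[k] H) := Matrix.of fun i j => Δ (e i j)
  let L : Matrix ι ι (H ⊗[k] H) := Matrix.of fun i j => Δ (antipode k (e i j))
  let R : Matrix ι ι (H ⊗[k] H) :=
    Matrix.of fun i j => ∑ l, antipode k (e l j) ⊗ₜ[k] antipode k (e i l)
  have hLM : L * M = 1 := by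
    ext i j
    simp only [Matrix.mul_apply, L, M, Matrix.of_apply, ← map_mul, ← map_sum, he.sum_antipode_mul, Matrix.one_apply]
    split_ifs <;> simp
  have hMR : M * R = 1 := by
    ext i j
    have h1 : ∀ l, M i l * R l j = ∑ a, ∑ b, (e i a * antipode k (e b j)) ⊗ₜ[k]
        (e a l * antipode k (e l b)) := fun l => by
      simp only [M, R, Δ, Matrix.of_apply, Bialgebra.comulAlgHom_apply, he.comul_eq, Finset.sum_mul_sum,
        Algebra.TensorProduct.tmul_mul_tmul]
    rw [Matrix.mul_apply, Finset.sum_congr rfl fun l _ => h1 l, Finset.sum_comm]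
    have h2 : ∀ a, ∑ l, ∑ b, (e i a * antipode k (e b j)) ⊗ₜ[k] (e a l * antipode k (e l b)) =
        (e i a * antipode k (e a j)) ⊗ₜ[k] (1 : H) := fun a => by
      rw [Finset.sum_comm]
      simp only [← TensorProduct.tmul_sum, he.sum_mul_antipode]
      simp [TensorProduct.tmul_ite]
    rw [Finset.sum_congr rfl fun a _ => h2 a, ← TensorProduct.sum_tmul, he.sum_mul_antipode,
      Matrix.one_apply]
    split_ifs <;> simp [Algebra.TensorProduct.one_def]
  have h : L = R := by
    calc L = L * (M * R) := by rw [hMR, mul_one]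
      _ = R := by rw [← mul_assoc, hLM, one_mul]
  exact congrFun (congrFun h i) j

end IsComatrix

end Comatrices

/-! ### Right ideals of module algebras -/

section RightIdealsOfModuleAlgebras

set_option linter.unusedSectionVars false

universe u v w

open TensorProduct Coalgebra HopfAlgebra MulOpposite

variable {k : Type u} {H : Type v} {A : Type w} [Field k] [Ring H] [HopfAlgebra k H]
  [Ring A] [Algebra k A] [Module H A] [IsModuleAlgebra k H A]
  {ι κ : Type*} [Fintype ι] [DecidableEq ι] [Fintype κ] [DecidableEq κ]
  {e : Matrix ι ι H} {f : Matrix κ κ H}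

theorem smul_mul_of_comul_eq {h : H} {x y : ι → H}
    (hxy : comul (R := k) h = ∑ l, x l ⊗ₜ[k] y l) (a b : A) :
    h • (a * b) = ∑ l, (x l • a) * (y l • b) := by
  rw [IsModuleAlgebra.smul_mul (k := k), hxy]
  simp

namespace IsComatrix

theorem smul_mul (he : IsComatrix k e) (i j : ι) (a b : A) :
    e i j • (a * b) = ∑ l, (e i l • a) * (e l j • b) :=
  smul_mul_of_comul_eq (he.comul_eq i j) a b

theorem antipode_smul_mul (he : IsComatrix k e) (i j : ι) (a b : A) :
    antipode k (e i j) • (a * b) =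
      ∑ l, (antipode k (e l j) • a) * (antipode k (e i l) • b) :=
  smul_mul_of_comul_eq (he.comul_antipode i j) a b

theorem sum_smul_antipode_smul (he : IsComatrix k e) (i j : ι) (a : A) :
    ∑ l, e i l • antipode k (e l j) • a = if i = j then a else 0 := by
  simp only [← mul_smul, ← Finset.sum_smul, he.sum_mul_antipode]
  split_ifs <;> simp

theorem sum_antipode_smul_smul (he : IsComatrix k e) (i j : ι) (a : A) :
    ∑ l, antipode k (e i l) • e l j • a = if i = j then a else 0 := by
  simp only [← mul_smul, ← Finset.sum_smul, he.sum_antipode_mul]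
  split_ifs <;> simp

/-- In Sweedler notation, `(h a) b = ∑ h₍₁₎ (a (S(h₍₂₎) b))`: if all `S(e l j) b` lie in an ideal
killed by `a`, then `e i j • a` kills `b`. -/
theorem smul_mul_eq_sum (he : IsComatrix k e) (i j : ι) (a b : A) :
    (e i j • a) * b = ∑ l, e i l • (a * (antipode k (e l j) • b)) := by
  simp only [he.smul_mul]
  rw [Finset.sum_comm]
  simp only [← Finset.mul_sum, he.sum_smul_antipode_smul]
  simp

/-- The companion formula `a (S(h) b) = ∑ S(h₍₁₎) ((h₍₂₎ a) b)` moves `S(h)` outside, as needed for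
(T3). -/
theorem mul_antipode_smul_eq_sum (he : IsComatrix k e) (i j : ι) (a b : A) :
    a * (antipode k (e i j) • b) = ∑ l, antipode k (e i l) • ((e l j • a) * b) := by
  simp only [he.antipode_smul_mul]
  rw [Finset.sum_comm]
  simp only [← Finset.sum_mul, he.sum_antipode_smul_smul]
  simp

theorem antipode_smul_one (he : IsComatrix k e) (i j : ι) :
    antipode k (e i j) • (1 : A) = if i = j then 1 else 0 := by
  have := he.mul_antipode_smul_eq_sum i j (1 : A) 1
  simpa [he.sum_antipode_smul_smul] using this

/-- The right ideal of all elements which are mapped to `I` by the antipodes of the entries of a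
comatrix. -/
def antipodeComap (he : IsComatrix k e) (I : RightIdeal A) : RightIdeal A where
  carrier := {y | ∀ i j, antipode k (e i j) • y ∈ I}
  add_mem' := fun hx hy i j => by rw [smul_add]; exact I.add_mem (hx i j) (hy i j)
  zero_mem' := fun i j => by rw [smul_zero]; exact I.zero_mem
  smul_mem' := fun c y hy i j => by
    rw [MulOpposite.smul_eq_mul_unop, he.antipode_smul_mul]
    exact I.sum_mem fun l _ => I.smul_mem (op _) (hy l j)

theorem mem_antipodeComap (he : IsComatrix k e) {I : RightIdeal A} {y : A} :
    y ∈ he.antipodeComap I ↔ ∀ i j, antipode k (e i j) • y ∈ I := Iff.rfl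

/-- The order of composition comes from `S(x y) = S(y) S(x)`. -/
theorem mem_antipodeComap_mul (he : IsComatrix k e) (hf : IsComatrix k f) {I : RightIdeal A}
    {y : A} : y ∈ (he.mul hf).antipodeComap I ↔ y ∈ he.antipodeComap (hf.antipodeComap I) := by
  simp only [mem_antipodeComap, Matrix.of_apply, antipode_mul_antidistrib, mul_smul, Prod.forall]
  constructor
  · intro h i j a b
    exact h i a j b
  · intro h i a j b
    exact h i j a b

end IsComatrix

namespace RightIdeal

theorem mul_mem {R : Type w} [Ring R] (I : RightIdeal R) {x : R} (hx : x ∈ I) (y : R) :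
    x * y ∈ I := I.smul_mem (op y) hx

theorem mem_colon {R : Type w} [Ring R] {I : RightIdeal R} {a x : R} :
    x ∈ I.colon a ↔ a * x ∈ I := Iff.rfl

namespace IsEssential

variable {R : Type w} [Ring R] {I J : RightIdeal R}

theorem top : (⊤ : RightIdeal R).IsEssential := fun K hK => by rwa [top_inf_eq]

theorem mono (hJ : J.IsEssential) (h : J ≤ I) : I.IsEssential := fun K hK h0 =>
  hJ K hK (le_bot_iff.1 ((inf_le_inf_right K h).trans h0.le))

theorem inf (hI : I.IsEssential) (hJ : J.IsEssential) : (I ⊓ J).IsEssential := fun K hK => by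
  rw [inf_assoc]
  exact hI _ (hJ K hK)

theorem colon (hI : I.IsEssential) (a : R) : (I.colon a).IsEssential := fun K hK h0 => by
  have h1 : K.map (leftMulHom a) ≠ ⊥ := fun h => hK (by
    rw [← h0, eq_comm, inf_eq_right]
    intro x hx
    have : leftMulHom a x ∈ K.map (leftMulHom a) := Submodule.mem_map_of_mem hx
    rw [h, Submodule.mem_bot] at this
    exact mem_colon.2 ((show a * x = 0 from this) ▸ I.zero_mem))
  obtain ⟨_, ⟨hxI, x, hx, rfl⟩, hx0⟩ := Submodule.exists_mem_ne_zero_of_ne_bot (hI _ h1)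
  have : x ∈ I.colon a ⊓ K := ⟨hxI, hx⟩
  rw [h0, Submodule.mem_bot] at this
  exact hx0 (by rw [this, map_zero])

theorem finset_inf {α : Type*} (s : Finset α) (J : α → RightIdeal R)
    (hJ : ∀ i ∈ s, (J i).IsEssential) : (s.inf J).IsEssential :=
  Finset.inf_induction top (fun _ h _ h' => h.inf h') hJ

theorem exists_mul_ne_zero (hI : I.IsEssential) {a : R} (ha : a ≠ 0) :
    ∃ x, a * x ∈ I ∧ a * x ≠ 0 := by
  have h1 : (⊤ : RightIdeal R).map (leftMulHom a) ≠ ⊥ := fun h => ha (by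
    have : leftMulHom a 1 ∈ (⊤ : RightIdeal R).map (leftMulHom a) := Submodule.mem_map_of_mem trivial
    rw [h, Submodule.mem_bot] at this
    exact (mul_one a).symm.trans this)
  obtain ⟨_, ⟨hxI, x, _, rfl⟩, hx0⟩ := Submodule.exists_mem_ne_zero_of_ne_bot (hI _ h1)
  exact ⟨x, hxI, hx0⟩

theorem of_exists_mul_ne_zero (h : ∀ a : R, a ≠ 0 → ∃ x, a * x ∈ I ∧ a * x ≠ 0) :
    I.IsEssential := fun K hK h0 => by
  obtain ⟨a, ha, ha0⟩ := Submodule.exists_mem_ne_zero_of_ne_bot hK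
  obtain ⟨x, hx, hx0⟩ := h a ha0
  have : a * x ∈ I ⊓ K := ⟨hx, K.mul_mem ha x⟩
  rw [h0, Submodule.mem_bot] at this
  exact hx0 this

end IsEssential

end RightIdeal

theorem IsComatrix.isEssential_antipodeComap {I : RightIdeal A} (hI : I ∈ hEssentialFilter k H A)
    (he : IsComatrix k e) : (he.antipodeComap I).IsEssential := by
  have h : ∀ p : ι × ι, ∃ J : RightIdeal A, J.IsEssential ∧
      ∀ x ∈ J, antipode k (e p.1 p.2) • x ∈ I := fun p => hI _ ⟨_, rfl⟩
  choose J hJ hJI using h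
  refine (RightIdeal.IsEssential.finset_inf Finset.univ J fun i _ => hJ i).mono fun x hx i j => ?_
  exact hJI (i, j) x ((Submodule.mem_finsetInf.1 hx) (i, j) (Finset.mem_univ _))

/-- A comatrix has finitely many entries, and finite intersections of essential right ideals are
essential. -/
theorem mem_hEssentialFilter_iff {I : RightIdeal A} : I ∈ hEssentialFilter k H A ↔
    ∀ (n : ℕ) (e : Matrix (Fin n) (Fin n) H) (he : IsComatrix k e),
      (he.antipodeComap I).IsEssential := by
  refine ⟨fun hI n e he => he.isEssential_antipodeComap hI, fun hI => ?_⟩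
  rintro _ ⟨h, rfl⟩
  obtain ⟨n, e, he, hh⟩ := exists_isComatrix (k := k) h
  refine ⟨_, hI n e he, fun x hx => ?_⟩
  induction hh using Submodule.span_induction with
  | mem h hh => obtain ⟨p, rfl⟩ := hh; exact hx _ _
  | zero => simp
  | add g h _ _ hg hh => rw [map_add, add_smul]; exact I.add_mem hg hh
  | smul c h _ hh =>
    rw [map_smul, smul_assoc, Algebra.smul_def, Algebra.commutes]
    exact I.mul_mem hh _

theorem IsComatrix.antipodeComap_mem_hEssentialFilter (he : IsComatrix k e) {I : RightIdeal A}
    (hI : I ∈ hEssentialFilter k H A) : he.antipodeComap I ∈ hEssentialFilter k H A :=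
  mem_hEssentialFilter_iff.2 fun _ _ hf =>
    ((hf.mul he).isEssential_antipodeComap hI).mono fun _ hx => (hf.mem_antipodeComap_mul he).1 hx

theorem isEssential_of_mem_hEssentialFilter {I : RightIdeal A}
    (hI : I ∈ hEssentialFilter k H A) : I.IsEssential := by
  obtain ⟨J, hJ, h⟩ := hI 1 ⟨1, antipode_one⟩
  exact hJ.mono fun x hx => by simpa using h x hx

theorem top_mem_hEssentialFilter : (⊤ : RightIdeal A) ∈ hEssentialFilter k H A := fun _ _ =>
  ⟨⊤, RightIdeal.IsEssential.top, fun _ _ => trivial⟩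

theorem hEssentialFilter_of_le {I J : RightIdeal A} (hJ : J ∈ hEssentialFilter k H A)
    (hle : J ≤ I) : I ∈ hEssentialFilter k H A := fun h hh =>
  let ⟨K, hK, hKJ⟩ := hJ h hh
  ⟨K, hK, fun x hx => hle (hKJ x hx)⟩

theorem inf_mem_hEssentialFilter {I J : RightIdeal A} (hI : I ∈ hEssentialFilter k H A)
    (hJ : J ∈ hEssentialFilter k H A) : I ⊓ J ∈ hEssentialFilter k H A := fun h hh =>
  let ⟨K, hK, hKI⟩ := hI h hh
  let ⟨L, hL, hLJ⟩ := hJ h hh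
  ⟨K ⊓ L, hK.inf hL, fun x hx => ⟨hKI x hx.1, hLJ x hx.2⟩⟩

theorem colon_mem_hEssentialFilter {I : RightIdeal A} (hI : I ∈ hEssentialFilter k H A) (a : A) :
    I.colon a ∈ hEssentialFilter k H A := by
  refine mem_hEssentialFilter_iff.2 fun n e he => ?_
  refine (RightIdeal.IsEssential.finset_inf Finset.univ
    (fun p : Fin n × Fin n => (he.antipodeComap I).colon (e p.1 p.2 • a)) fun p _ =>
      (he.isEssential_antipodeComap hI).colon _).mono fun x hx i j => ?_
  rw [RightIdeal.mem_colon, he.mul_antipode_smul_eq_sum]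
  exact I.sum_mem fun l _ => (Submodule.mem_finsetInf.1 hx) (l, j) (Finset.mem_univ _) i l

/-- If `A` is `H`-semiprime, then a set of right ideals `𝒢` with suitable closure properties
annihilates no nonzero elements, provided that the annihilated elements lie in a nilpotent ideal. -/
theorem eq_zero_of_annihilated (hsemi : IsHSemiprime H A) (N : Ideal Aᵐᵒᵖ) [N.IsTwoSided]
    (hN : IsNilpotent N) (𝒢 : Set (RightIdeal A)) (htop : ⊤ ∈ 𝒢)
    (hinf : ∀ I ∈ 𝒢, ∀ J ∈ 𝒢, I ⊓ J ∈ 𝒢) (hcolon : ∀ I ∈ 𝒢, ∀ a, RightIdeal.colon I a ∈ 𝒢)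
    (hcomap : ∀ (n : ℕ) (e : Matrix (Fin n) (Fin n) H) (he : IsComatrix k e), ∀ I ∈ 𝒢,
      he.antipodeComap I ∈ 𝒢)
    (h𝒢 : ∀ a, ∀ I ∈ 𝒢, (∀ x ∈ I, a * x = 0) → op a ∈ N) :
    ∀ I ∈ 𝒢, ∀ a : A, (∀ x ∈ I, a * x = 0) → a = 0 := by
  let T : Ideal A :=
    { carrier := {a | ∃ I ∈ 𝒢, ∀ x ∈ I, a * x = 0}
      add_mem' := fun ⟨I, hI, h⟩ ⟨J, hJ, h'⟩ => ⟨I ⊓ J, hinf I hI J hJ, fun x hx => by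
        rw [add_mul, h x hx.1, h' x hx.2, add_zero]⟩
      zero_mem' := ⟨⊤, htop, fun x _ => zero_mul x⟩
      smul_mem' := fun c a ⟨I, hI, h⟩ => ⟨I, hI, fun x hx => by
        rw [smul_eq_mul, mul_assoc, h x hx, mul_zero]⟩ }
  have hT : T = ⊥ := by
    refine hsemi T ⟨fun {a} b ⟨I, hI, h⟩ => ⟨I.colon b, hcolon I hI b, fun x hx => by
      rw [mul_assoc]; exact h _ hx⟩⟩ (fun h a ⟨I, hI, ha⟩ => ?_) ?_
    · refine forall_of_isComatrix (k := k) (P := fun h => h • a ∈ T) (fun x y hx hy => ?_) ?_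
        (fun c x hx => ?_) (fun n e he i j => ⟨_, hcomap n e he I hI, fun x hx => ?_⟩) h
      · rw [add_smul]; exact T.add_mem hx hy
      · rw [zero_smul]; exact T.zero_mem
      · rw [smul_assoc, Algebra.smul_def]; exact T.mul_mem_left _ hx
      -- `(e i j • a) x = ∑ e i l • (a (S(e l j) x))`, and every `S(e l j) x` lies in `I`.
      · rw [he.smul_mul_eq_sum]
        exact Finset.sum_eq_zero fun l _ => by rw [ha _ (hx l j), smul_zero]
    · obtain ⟨m, hm⟩ := hN
      refine ⟨m, le_bot_iff.1 fun x hx => ?_⟩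
      have key : ∀ m : ℕ, ∀ x ∈ T ^ m, op x ∈ N ^ m := fun m => by
        induction m with
        | zero => intro x _; rw [Submodule.pow_zero, Ideal.one_eq_top]; trivial
        | succ m ih =>
          intro x hx
          rw [Submodule.pow_succ] at hx
          refine Submodule.smul_induction_on hx (fun r hr a ⟨I, hI, ha⟩ => ?_) fun x y hx hy => ?_
          · rw [smul_eq_mul, op_mul, Ideal.IsTwoSided.pow_succ]
            exact Ideal.mul_mem_mul (h𝒢 a I hI ha) (ih r hr)
          · rw [op_add]; exact Ideal.add_mem _ hx hy
      have := key m x hx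
      rw [hm] at this
      exact (op_eq_zero_iff x).1 this
  intro I hI a ha
  have : a ∈ T := ⟨I, hI, ha⟩
  rwa [hT] at this

/-- Rows of elements of `A` with the right action of `A` twisted by a comatrix. -/
def TwistedRow (_ : IsComatrix k e) (A : Type w) : Type _ := ι → A

/-! ### Density for rows twisted by the antipode -/

namespace TwistedRow

instance (he : IsComatrix k e) : AddCommGroup (TwistedRow he A) :=
  inferInstanceAs (AddCommGroup (ι → A))

instance (he : IsComatrix k e) : Module Aᵐᵒᵖ (TwistedRow he A) where
  smul c f := fun j => ∑ i, f i * (antipode k (e j i) • c.unop)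
  one_smul f := by
    funext j
    change ∑ i, f i * (antipode k (e j i) • (1 : A)) = f j
    simp only [he.antipode_smul_one, mul_ite, mul_one, mul_zero]
    exact (Finset.sum_ite_eq Finset.univ j fun x => f x).trans (if_pos (Finset.mem_univ j))
  mul_smul c d f := by
    funext j
    change ∑ i, f i * (antipode k (e j i) • (d.unop * c.unop)) =
      ∑ i, (∑ l, f l * (antipode k (e i l) • d.unop)) * (antipode k (e j i) • c.unop)
    simp only [he.antipode_smul_mul, Finset.mul_sum, Finset.sum_mul, mul_assoc]
    exact Finset.sum_comm
  smul_zero c := by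
    funext j
    change ∑ i, (0 : A) * (antipode k (e j i) • c.unop) = 0
    simp
  smul_add c f g := by
    funext j
    change ∑ i, (f i + g i) * (antipode k (e j i) • c.unop) =
      ∑ i, f i * (antipode k (e j i) • c.unop) + ∑ i, g i * (antipode k (e j i) • c.unop)
    simp only [add_mul, Finset.sum_add_distrib]
  add_smul c d f := by
    funext j
    change ∑ i, f i * (antipode k (e j i) • (c.unop + d.unop)) =
      ∑ i, f i * (antipode k (e j i) • c.unop) + ∑ i, f i * (antipode k (e j i) • d.unop)
    simp only [smul_add, mul_add, Finset.sum_add_distrib]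
  zero_smul f := by
    funext j
    change ∑ i, f i * (antipode k (e j i) • (0 : A)) = 0
    simp

variable (he : IsComatrix k e)

theorem smul_apply (c : Aᵐᵒᵖ) (f : TwistedRow he A) (j : ι) :
    (c • f) j = ∑ i, f i * (antipode k (e j i) • c.unop) := rfl

theorem add_apply (f g : TwistedRow he A) (j : ι) : (f + g) j = f j + g j := rfl

/-- Applying `S(e)` maps the untwisted rows onto the twisted ones, since `S(e) e = 1` provides
preimages; bijectivity of `S` is not needed. -/
instance [IsNoetherian Aᵐᵒᵖ A] : IsNoetherian Aᵐᵒᵖ (TwistedRow he A) := by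
  let g : (ι → A) →ₗ[Aᵐᵒᵖ] TwistedRow he A :=
    { toFun := fun y j => ∑ i, antipode k (e j i) • y i
      map_add' := fun x y => by
        funext j
        change ∑ i, antipode k (e j i) • (x i + y i) =
          ∑ i, antipode k (e j i) • x i + ∑ i, antipode k (e j i) • y i
        simp only [smul_add, Finset.sum_add_distrib]
      map_smul' := fun c y => by
        funext j
        change ∑ i, antipode k (e j i) • (y i * c.unop) =
          ∑ i, (∑ l, antipode k (e i l) • y l) * (antipode k (e j i) • c.unop)
        simp only [he.antipode_smul_mul, Finset.sum_mul]
        exact Finset.sum_comm }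
  refine isNoetherian_of_surjective g (LinearMap.range_eq_top.2 fun f => ?_)
  refine ⟨fun i => ∑ m, e i m • f m, ?_⟩
  funext j
  change ∑ i, antipode k (e j i) • ∑ m, e i m • f m = f j
  simp only [Finset.smul_sum]
  rw [Finset.sum_comm]
  simp only [he.sum_antipode_smul_smul]
  exact (Finset.sum_ite_eq Finset.univ j fun x => f x).trans (if_pos (Finset.mem_univ j))

/-- Rows with entries in a right ideal. -/
def entriesIn (I : RightIdeal A) : Submodule Aᵐᵒᵖ (TwistedRow he A) where
  carrier := {f | ∀ i, f i ∈ I}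
  add_mem' := fun hf hg i => I.add_mem (hf i) (hg i)
  zero_mem' := fun _ => I.zero_mem
  smul_mem' := fun c f hf j => by
    rw [smul_apply]
    exact I.sum_mem fun i _ => I.mul_mem (hf i) _

/-- Left multiplication on twisted rows. -/
def leftMul (v : A) : TwistedRow he A →ₗ[Aᵐᵒᵖ] TwistedRow he A where
  toFun f := fun i => v * f i
  map_add' f g := by funext i; exact mul_add _ _ _
  map_smul' c f := by
    funext j
    change v * ∑ i, f i * (antipode k (e j i) • c.unop) =
      ∑ i, (v * f i) * (antipode k (e j i) • c.unop)
    simp only [Finset.mul_sum, mul_assoc]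

/-- The row of the values of the antipodes of entries of a column of the comatrix. -/
def ofElement (j : ι) : A →ₗ[Aᵐᵒᵖ] TwistedRow he A where
  toFun y := fun i => antipode k (e i j) • y
  map_add' x y := by funext i; exact smul_add _ _ _
  map_smul' c y := by
    funext i
    change antipode k (e i j) • (y * c.unop) = _
    rw [he.antipode_smul_mul]
    rfl

/-- The chain of row modules `cⁿF + NF`, where `F` is all rows and `NF` denotes those with entries
in `N`, becomes dense. Cancelling `cⁿ` modulo `N` moves each row into `cF + NF`, whose entries lie
in `K`. -/
theorem entriesIn_isDenseIn_of_mem [IsNoetherian Aᵐᵒᵖ A] [IsNoetherianRing Aᵐᵒᵖ]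
    (N : Ideal Aᵐᵒᵖ) [N.IsTwoSided]
    (hN : ∀ a, (∀ c, a * c * a ∈ N) → a ∈ N) (hnil : IsNilpotent N) (K : RightIdeal A)
    (hNK : ∀ a, op a ∈ N → a ∈ K) {c : A} (hc : op c ∈ regularModulo N) (hcK : c ∈ K) :
    (entriesIn he K).IsDenseIn (regularModulo N) ⊤ := by
  let X : ℕ → Submodule Aᵐᵒᵖ (TwistedRow he A) := fun n =>
    { carrier := {f | ∃ g : TwistedRow he A, ∀ i, op (f i - c ^ n * g i) ∈ N}
      add_mem' := fun {f f'} ⟨g, hg⟩ ⟨g', hg'⟩ => ⟨g + g', fun i => by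
        have := N.add_mem (hg i) (hg' i)
        rwa [← op_add, show f i - c ^ n * g i + (f' i - c ^ n * g' i) =
          (f + f') i - c ^ n * (g + g') i by rw [add_apply, add_apply, mul_add]; abel] at this⟩
      zero_mem' := ⟨0, fun i => by
        change op (0 - c ^ n * 0) ∈ N
        simp⟩
      smul_mem' := fun d f ⟨g, hg⟩ => ⟨d • g, fun j => by
        have : (d • f) j - c ^ n * (d • g) j =
            ∑ i, (f i - c ^ n * g i) * (antipode k (e j i) • d.unop) := by
          simp only [smul_apply, sub_mul, Finset.sum_sub_distrib, Finset.mul_sum, mul_assoc]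
        rw [this, Finset.op_sum]
        exact N.sum_mem fun i _ => by rw [op_mul]; exact N.mul_mem_left _ (hg i)⟩ }
  have hX : Antitone X := antitone_nat_of_succ_le fun n f ⟨g, hg⟩ =>
    ⟨leftMul he c g, fun i => by
      have := hg i
      rwa [pow_succ, mul_assoc] at this⟩
  obtain ⟨n, hn⟩ := eventually_isDenseIn N hN hnil _ X hX
  have hcn : ∀ n : ℕ, ∀ x, op (c ^ n * x) ∈ N → op x ∈ N := fun n => by
    induction n with
    | zero => simp
    | succ n ih =>
      intro x hx
      rw [pow_succ, mul_assoc] at hx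
      exact hc.1 _ (by rw [← op_mul]; exact ih _ hx)
  intro f _
  obtain ⟨d, hd, g, hg⟩ := hn n le_rfl (leftMul he (c ^ n) f) ⟨f, fun i => by
    change op (c ^ n * f i - c ^ n * f i) ∈ N
    simp⟩
  refine ⟨d, hd, fun i => ?_⟩
  have h1 : op ((d • f) i - c * g i) ∈ N := by
    refine hcn n _ ?_
    have := hg i
    rw [← map_smul] at this
    change op (c ^ n * (d • f) i - c ^ (n + 1) * g i) ∈ N at this
    rwa [pow_succ, mul_assoc, ← mul_sub] at this
  have h2 := K.add_mem (hNK _ h1) (K.mul_mem hcK (g i))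
  rwa [sub_add_cancel] at h2

/-- Induction through `I + N ^ m`, which is `I` for large `m`. If `x` is an entry in `I + N ^ m`,
the conductor of `x` into `I + N ^ (m + 1)` contains `N` and, by density of `I`, an element regular
modulo `N`, so the preceding lemma applies to it. -/
theorem entriesIn_isDenseIn [IsNoetherian Aᵐᵒᵖ A] [IsNoetherianRing Aᵐᵒᵖ]
    (N : Ideal Aᵐᵒᵖ) [N.IsTwoSided]
    (hN : ∀ a, (∀ c, a * c * a ∈ N) → a ∈ N) (hnil : IsNilpotent N) (I : RightIdeal A)
    (hI : I.IsDenseIn (regularModulo N) ⊤) :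
    (entriesIn he I).IsDenseIn (regularModulo N) ⊤ := by
  let R : ℕ → RightIdeal A := fun m =>
    { carrier := {a | op a ∈ N ^ m}
      add_mem' := fun ha hb => (N ^ m).add_mem ha hb
      zero_mem' := (N ^ m).zero_mem
      smul_mem' := fun c a ha => (N ^ m).mul_mem_left c ha }
  have key : ∀ m, (entriesIn he (I ⊔ R m)).IsDenseIn (regularModulo N) ⊤ := by
    intro m
    induction m with
    | zero =>
      refine fun f _ => ⟨1, one_mem_regularModulo N, fun i => Submodule.mem_sup_right ?_⟩
      change op _ ∈ N ^ 0
      rw [Submodule.pow_zero, Ideal.one_eq_top]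
      trivial
    | succ m ih =>
      intro f _
      obtain ⟨d, hd, hdf⟩ := ih f trivial
      let E : ι → TwistedRow he A := fun i => (Pi.single i 1 : ι → A)
      -- The twisted action prevents treating entries separately. The row is split as a sum of left
      -- multiples of standard rows, which are moved one summand at a time.
      have hsum : d • f = ∑ i, leftMul he ((d • f) i) (E i) := by
        funext j
        have h1 : ∀ s : Finset ι, (∑ i ∈ s, leftMul he ((d • f) i) (E i)) j =
            ∑ i ∈ s, (d • f) i * (Pi.single i 1 : ι → A) j := fun s => Finset.sum_apply j s _
        rw [h1]
        simp only [Pi.single_apply, mul_ite, mul_one, mul_zero]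
        exact ((Finset.sum_ite_eq Finset.univ j fun x => (d • f) x).trans
          (if_pos (Finset.mem_univ j))).symm
      have hK : ∀ i, ∀ g : TwistedRow he A, ∃ c ∈ regularModulo N,
          c • leftMul he ((d • f) i) g ∈ entriesIn he (I ⊔ R (m + 1)) := by
        intro i g
        obtain ⟨c, hc, hcI⟩ := hI ((d • f) i) trivial
        obtain ⟨b, hb, hbg⟩ := entriesIn_isDenseIn_of_mem he N hN hnil
          ((I ⊔ R (m + 1)).colon ((d • f) i)) (fun a ha => by
            obtain ⟨x, hx, r, hr, hxr⟩ := Submodule.mem_sup.1 (hdf i)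
            rw [RightIdeal.mem_colon, ← hxr, add_mul]
            refine Submodule.add_mem_sup (I.mul_mem hx a) ?_
            change op (r * a) ∈ N ^ (m + 1)
            rw [op_mul, Ideal.IsTwoSided.pow_succ]
            exact Ideal.mul_mem_mul ha hr)
          (c := c.unop) hc (Submodule.mem_sup_left hcI) g trivial
        refine ⟨b, hb, ?_⟩
        rw [← map_smul]
        exact hbg
      have hfin : ∀ s : Finset ι, ∃ c ∈ regularModulo N,
          c • ∑ i ∈ s, leftMul he ((d • f) i) (E i) ∈ entriesIn he (I ⊔ R (m + 1)) := by
        classical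
        intro s
        induction s using Finset.induction_on with
        | empty => exact ⟨1, one_mem_regularModulo N, by simp⟩
        | insert i s his ih =>
          obtain ⟨c, hc, hcs⟩ := ih
          obtain ⟨b, hb, hbi⟩ := hK i (c • E i)
          refine ⟨b * c, mul_mem_regularModulo hb hc, ?_⟩
          rw [Finset.sum_insert his, smul_add, mul_smul, ← map_smul _ c, mul_smul]
          exact Submodule.add_mem _ hbi (Submodule.smul_mem _ _ hcs)
      obtain ⟨c, hc, hcf⟩ := hfin Finset.univ
      exact ⟨c * d, mul_mem_regularModulo hc hd, by rwa [mul_smul, hsum]⟩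
  obtain ⟨m, hm⟩ := hnil
  have hR : R m = ⊥ := le_bot_iff.1 fun a ha => by
    have ha' : op a ∈ N ^ m := ha
    rw [hm] at ha'
    exact (op_eq_zero_iff a).1 ha'
  have := key m
  rwa [hR, sup_bot_eq] at this

end TwistedRow

/-- For fixed `j` the map `y ↦ (S(e i j) y)ᵢ` is right linear into twisted rows; the finitely many
columns are handled successively. -/
theorem IsComatrix.antipodeComap_isDenseIn [IsNoetherian Aᵐᵒᵖ A] [IsNoetherianRing Aᵐᵒᵖ]
    (he : IsComatrix k e) (N : Ideal Aᵐᵒᵖ) [N.IsTwoSided]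
    (hN : ∀ a, (∀ c, a * c * a ∈ N) → a ∈ N) (hnil : IsNilpotent N) (I : RightIdeal A)
    (hI : I.IsDenseIn (regularModulo N) ⊤) :
    (he.antipodeComap I).IsDenseIn (regularModulo N) ⊤ := by
  intro y _
  have hfin : ∀ s : Finset ι, ∃ c ∈ regularModulo N, ∀ j ∈ s,
      TwistedRow.ofElement he j (c • y) ∈ TwistedRow.entriesIn he I := by
    intro s
    induction s using Finset.induction_on with
    | empty => exact ⟨1, one_mem_regularModulo N, by simp⟩
    | insert j s _ ih =>
      obtain ⟨c, hc, hcs⟩ := ih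
      obtain ⟨b, hb, hbj⟩ := TwistedRow.entriesIn_isDenseIn he N hN hnil I hI
        (TwistedRow.ofElement he j (c • y)) trivial
      refine ⟨b * c, mul_mem_regularModulo hb hc, fun l hl => ?_⟩
      rw [mul_smul, map_smul]
      rcases Finset.mem_insert.1 hl with rfl | hl
      · exact hbj
      · exact Submodule.smul_mem _ _ (hcs l hl)
  obtain ⟨c, hc, h⟩ := hfin Finset.univ
  exact ⟨c, hc, fun i j => h j (Finset.mem_univ _) i⟩

end RightIdealsOfModuleAlgebras

/-! ### The Gabriel topology of an `H`-semiprime right Noetherian algebra -/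

section HEssentialTopology

universe u v w

open TensorProduct Coalgebra HopfAlgebra MulOpposite

theorem isNoetherianRing_op {R : Type w} [Ring R] [IsNoetherian Rᵐᵒᵖ R] : IsNoetherianRing Rᵐᵒᵖ := by
  let g : R →ₗ[Rᵐᵒᵖ] Rᵐᵒᵖ :=
    { toFun := op
      map_add' := op_add
      map_smul' := fun _ _ => rfl }
  exact isNoetherian_of_surjective g (LinearMap.range_eq_top.2 op_surjective)

/-- If `I` is an essential right ideal of a right Noetherian ring, then the elements `a` with
`a I = 0` lie in each semiprime ideal. -/
theorem op_mem_of_mul_essential_eq_zero {R : Type w} [Ring R] [IsNoetherian Rᵐᵒᵖ R]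
    (N : Ideal Rᵐᵒᵖ) [N.IsTwoSided] (hN : ∀ a, (∀ c, a * c * a ∈ N) → a ∈ N)
    {I : RightIdeal R} (hI : I.IsEssential) {a : R} (ha : ∀ x ∈ I, a * x = 0) : op a ∈ N := by
  have := isNoetherianRing_op (R := R)
  refine le_of_nil_modulo N hN (Ideal.span {op a}) (fun x hx => ?_) (Ideal.subset_span rfl)
  obtain ⟨b, rfl⟩ := Ideal.mem_span_singleton'.1 hx
  obtain ⟨n, hn⟩ := isNilpotent_of_essential_annihilator (b * op a) fun K hK => by
    let K' : RightIdeal R :=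
      { carrier := {x | op x ∈ K}
        add_mem' := fun hx hy => K.add_mem hx hy
        zero_mem' := K.zero_mem
        smul_mem' := fun c x hx => K.mul_mem_left c hx }
    have hK' : K' ≠ ⊥ := fun h => hK (le_bot_iff.1 fun x hx => by
      have : x.unop ∈ K' := hx
      rw [h, Submodule.mem_bot] at this
      exact (unop_eq_zero_iff x).1 this)
    obtain ⟨x, hx, hx0⟩ := Submodule.exists_mem_ne_zero_of_ne_bot (hI.colon b.unop K' hK')
    refine ⟨op x, hx.2, (op_ne_zero_iff x).2 hx0, ?_⟩
    have h1 : a * (b.unop * x) = 0 := ha _ hx.1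
    rw [← op_unop b, ← op_mul, ← op_mul, mul_assoc, h1, op_zero]
  exact ⟨n, by rw [hn]; exact N.zero_mem⟩

variable {k : Type u} {H : Type v} {A : Type w} [Field k] [Ring H] [HopfAlgebra k H]
  [Ring A] [Algebra k A] [Module H A] [IsModuleAlgebra k H A]

theorem eq_zero_of_mul_hEssential [IsNoetherian Aᵐᵒᵖ A] (hsemi : IsHSemiprime H A) :
    ∀ I ∈ hEssentialFilter k H A, ∀ a : A, (∀ x ∈ I, a * x = 0) → a = 0 := by
  have := isNoetherianRing_op (R := A)
  obtain ⟨N, _, hnil, hN⟩ := exists_nilpotent_semiprime_ideal Aᵐᵒᵖ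
  exact eq_zero_of_annihilated (k := k) hsemi N hnil _ top_mem_hEssentialFilter
    (fun _ hI _ hJ => inf_mem_hEssentialFilter hI hJ) (fun _ hI a => colon_mem_hEssentialFilter hI a)
    (fun _ _ he _ hI => he.antipodeComap_mem_hEssentialFilter hI)
    fun a I hI ha => op_mem_of_mul_essential_eq_zero N hN (isEssential_of_mem_hEssentialFilter hI) ha

/-- For `a ≠ 0` essentiality gives a nonzero `a * x` in `antipodeComap J`. Its conductor into
`antipodeComap I` is in the filter, so by torsionfreeness it does not kill `a * x`. -/
theorem hEssentialFilter_of_colon_mem [IsNoetherian Aᵐᵒᵖ A] (hsemi : IsHSemiprime H A)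
    {I J : RightIdeal A} (hJ : J ∈ hEssentialFilter k H A)
    (h : ∀ a ∈ J, I.colon a ∈ hEssentialFilter k H A) : I ∈ hEssentialFilter k H A := by
  refine mem_hEssentialFilter_iff.2 fun n e he => ?_
  have hcolon : ∀ b ∈ he.antipodeComap J,
      (he.antipodeComap I).colon b ∈ hEssentialFilter k H A := by
    intro b hb
    have hinf : ((Finset.univ : Finset (Fin n × Fin n)).inf fun p =>
        he.antipodeComap (I.colon (antipode k (e p.1 p.2) • b))) ∈ hEssentialFilter k H A :=
      Finset.inf_induction top_mem_hEssentialFilter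
        (fun _ hK _ hL => inf_mem_hEssentialFilter hK hL)
        fun p _ => he.antipodeComap_mem_hEssentialFilter (h _ (hb _ _))
    refine hEssentialFilter_of_le hinf fun x hx i j => ?_
    rw [show leftMulHom b x = b * x from rfl, he.antipode_smul_mul]
    exact I.sum_mem fun l _ => (Submodule.mem_finsetInf.1 hx) (l, j) (Finset.mem_univ _) i l
  refine RightIdeal.IsEssential.of_exists_mul_ne_zero fun a ha => ?_
  obtain ⟨x, hx, hx0⟩ := (he.isEssential_antipodeComap hJ).exists_mul_ne_zero ha
  by_contra! hne
  refine hx0 (eq_zero_of_mul_hEssential (k := k) hsemi _ (hcolon _ hx) _ fun y hy => ?_)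
  rw [mul_assoc]
  refine hne _ ?_
  rw [← mul_assoc]
  exact hy

variable (k) in
/-- The Gabriel topology of all right ideals `I` such that for each `h` in the image of the
antipode `h J ⊆ I` for some essential right ideal `J`. -/
def hEssentialTopology [IsNoetherian Aᵐᵒᵖ A] (hsemi : IsHSemiprime H A) :
    RightGabrielTopology A where
  carrier := hEssentialFilter k H A
  top_mem := top_mem_hEssentialFilter
  mem_of_le _ _ := hEssentialFilter_of_le
  inf_mem _ _ := inf_mem_hEssentialFilter
  colon_mem _ := colon_mem_hEssentialFilter
  mem_of_colon_mem _ _ := hEssentialFilter_of_colon_mem hsemi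

theorem isTorsionFree_hEssentialTopology [IsNoetherian Aᵐᵒᵖ A] (hsemi : IsHSemiprime H A) :
    (hEssentialTopology k hsemi).IsTorsionFree := eq_zero_of_mul_hEssential hsemi

/-- Dense right ideals are closed under conductors and `antipodeComap`, hence kill nothing by
`H`-semiprimeness. Any right ideal whose conductors all kill nothing nonzero is essential. -/
theorem mem_hEssentialFilter_of_isDenseIn [IsNoetherian Aᵐᵒᵖ A] [IsNoetherianRing Aᵐᵒᵖ]
    (hsemi : IsHSemiprime H A) (N : Ideal Aᵐᵒᵖ) [N.IsTwoSided]
    (hN : ∀ a, (∀ c, a * c * a ∈ N) → a ∈ N) (hnil : IsNilpotent N) {I : RightIdeal A}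
    (hI : I.IsDenseIn (regularModulo N) ⊤) : I ∈ hEssentialFilter k H A := by
  have hcolon : ∀ I : RightIdeal A, I.IsDenseIn (regularModulo N) ⊤ →
      ∀ a, (I.colon a).IsDenseIn (regularModulo N) ⊤ := fun I hI a x _ => by
    obtain ⟨c, hc, h⟩ := hI (a * x) trivial
    exact ⟨c, hc, by
      rwa [RightIdeal.mem_colon, MulOpposite.smul_eq_mul_unop, ← mul_assoc]⟩
  have hzero := eq_zero_of_annihilated (k := k) hsemi N hnil
    {I | I.IsDenseIn (regularModulo N) ⊤} (fun x _ => ⟨1, one_mem_regularModulo N, trivial⟩)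
    (fun I hI J hJ x _ => by
      obtain ⟨c, hc, h⟩ := hI x trivial
      obtain ⟨d, hd, h'⟩ := hJ (c • x) trivial
      exact ⟨d * c, mul_mem_regularModulo hd hc, by
        rw [mul_smul]; exact ⟨I.smul_mem d h, h'⟩⟩)
    hcolon (fun n e he I hI => he.antipodeComap_isDenseIn N hN hnil I hI)
    fun a I hI ha => by
      obtain ⟨c, hc, h⟩ := hI 1 trivial
      rw [MulOpposite.smul_eq_mul_unop, one_mul] at h
      refine hc.2 _ ?_
      rw [← op_unop c, ← op_mul, ha _ h, op_zero]
      exact N.zero_mem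
  refine mem_hEssentialFilter_iff.2 fun n e he => ?_
  refine RightIdeal.IsEssential.of_exists_mul_ne_zero fun a ha => ?_
  by_contra! hne
  exact ha (hzero _ (hcolon _ (he.antipodeComap_isDenseIn N hN hnil I hI) a) a hne)

theorem hasDenseChains_hEssentialTopology [IsNoetherian Aᵐᵒᵖ A] (hsemi : IsHSemiprime H A) :
    (hEssentialTopology k hsemi).HasDenseChains := by
  have := isNoetherianRing_op (R := A)
  obtain ⟨N, _, hnil, hN⟩ := exists_nilpotent_semiprime_ideal Aᵐᵒᵖ
  intro X hX
  obtain ⟨n, hn⟩ := eventually_isDenseIn N hN hnil A X hX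
  refine ⟨n, fun x hx => mem_hEssentialFilter_of_isDenseIn hsemi N hN hnil fun a _ => ?_⟩
  obtain ⟨c, hc, h⟩ := hn n le_rfl (x * a) ((X n).mul_mem hx a)
  exact ⟨c, hc, by rwa [RightIdeal.mem_colon, MulOpposite.smul_eq_mul_unop, ← mul_assoc]⟩

end HEssentialTopology

/-! ### Extension of the action of `H` to the quotient ring -/

section ExtensionOfAction

universe u v w

open TensorProduct Coalgebra HopfAlgebra MulOpposite RightGabrielTopology

variable {k : Type u} {H : Type v} {A : Type w} [Field k] [Ring H] [HopfAlgebra k H]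
  [Ring A] [Algebra k A]

/-! ### The action of `H` on linear endomorphisms -/

section HomAction

variable [Module H A] [IsScalarTower k H A]

variable (k H A) in
/-- The action of `H` on the linear endomorphisms of an `H`-module,
`(h f)(x) = ∑ h₍₁₎ f(S(h₍₂₎) x)`. -/
noncomputable def homAction : H →ₗ[k] Module.End k A →ₗ[k] Module.End k A :=
  haveI : SMulCommClass H k A := IsScalarTower.to_smulCommClass' (R := k) (A := H) (M := A)
  TensorProduct.lift ((LinearMap.mul k (Module.End k (Module.End k A))).compl₁₂
    (LinearMap.mul k (Module.End k A) ∘ₗ (Algebra.lsmul k k A : H →ₐ[k] Module.End k A).toLinearMap)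
    ((LinearMap.mul k (Module.End k A)).flip ∘ₗ
      (Algebra.lsmul k k A : H →ₐ[k] Module.End k A).toLinearMap ∘ₗ antipode k)) ∘ₗ comul

theorem homAction_apply {ι : Type*} [Fintype ι] {h : H} {x y : ι → H}
    (hxy : comul (R := k) h = ∑ l, x l ⊗ₜ[k] y l) (f : Module.End k A) (a : A) :
    homAction k H A h f a = ∑ l, x l • f (antipode k (y l) • a) := by
  simp only [homAction, LinearMap.comp_apply, hxy, map_sum, TensorProduct.lift.tmul,
    LinearMap.sum_apply]
  rfl

theorem IsComatrix.homAction_apply {ι : Type*} [Fintype ι] [DecidableEq ι] {e : Matrix ι ι H}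
    (he : IsComatrix k e) (i j : ι) (f : Module.End k A) (a : A) :
    homAction k H A (e i j) f a = ∑ l, e i l • f (antipode k (e l j) • a) :=
  _root_.homAction_apply (he.comul_eq i j) f a

theorem homAction_one (f : Module.End k A) : homAction k H A 1 f = f := by
  ext a
  rw [homAction_apply (ι := Unit) (x := fun _ => 1) (y := fun _ => 1)
    (by simp [Algebra.TensorProduct.one_def])]
  simp

theorem homAction_mul (g h : H) (f : Module.End k A) :
    homAction k H A (g * h) f = homAction k H A g (homAction k H A h f) := by
  refine forall_of_isComatrix (k := k) (P := fun g => homAction k H A (g * h) f =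
    homAction k H A g (homAction k H A h f)) (fun x y hx hy => ?_) ?_ (fun c x hx => ?_)
    (fun n e he i j => ?_) g
  · rw [add_mul, map_add, map_add, LinearMap.add_apply, LinearMap.add_apply, hx, hy]
  · rw [zero_mul, map_zero, LinearMap.zero_apply, LinearMap.zero_apply]
  · rw [smul_mul_assoc, map_smul, map_smul, LinearMap.smul_apply, LinearMap.smul_apply, hx]
  refine forall_of_isComatrix (k := k) (P := fun h => homAction k H A (e i j * h) f =
    homAction k H A (e i j) (homAction k H A h f)) (fun x y hx hy => ?_) ?_ (fun c x hx => ?_)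
    (fun m e' he' i' j' => ?_) h
  · rw [mul_add, map_add, map_add, LinearMap.add_apply, LinearMap.add_apply, map_add, hx, hy]
  · rw [mul_zero, map_zero, LinearMap.zero_apply, map_zero]
  · rw [mul_smul_comm, map_smul, map_smul, LinearMap.smul_apply, LinearMap.smul_apply, map_smul, hx]
  ext a
  have h1 := (he.mul he').homAction_apply (i, i') (j, j') f a
  simp only [Matrix.of_apply, antipode_mul_antidistrib, mul_smul, Fintype.sum_prod_type] at h1
  rw [h1, he.homAction_apply]
  simp only [he'.homAction_apply, Finset.smul_sum]

/-- The inner `S(e c l) e l b` sum to `δ`, which leaves the single outer action on `f * g`. -/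
theorem IsComatrix.homAction_mul_apply {ι : Type*} [Fintype ι] [DecidableEq ι] {e : Matrix ι ι H}
    (he : IsComatrix k e) (i j : ι) (f g : Module.End k A) :
    homAction k H A (e i j) (f * g) =
      ∑ l, homAction k H A (e i l) f * homAction k H A (e l j) g := by
  ext a
  simp only [LinearMap.sum_apply, Module.End.mul_apply, he.homAction_apply, map_sum,
    Finset.smul_sum]
  rw [eq_comm, Finset.sum_comm]
  refine Finset.sum_congr rfl fun c _ => ?_
  rw [Finset.sum_comm]
  have h2 : ∀ b : ι, ∑ l, e i c • f (antipode k (e c l) • e l b • g (antipode k (e b j) • a)) =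
      if c = b then e i c • f (g (antipode k (e b j) • a)) else 0 := fun b => by
    simp only [← Finset.smul_sum, ← map_sum, ← mul_smul, ← Finset.sum_smul, he.sum_antipode_mul]
    split_ifs <;> simp
  rw [Finset.sum_congr rfl fun b _ => h2 b]
  exact (Finset.sum_ite_eq Finset.univ c _).trans (if_pos (Finset.mem_univ c))

end HomAction

namespace RightGabrielTopology

variable {G : RightGabrielTopology A}

/-- The linear map `f` agrees with the left multiplication by `q` on a right ideal from `G`. -/
def Represents (f : Module.End k A) (q : G.QuotientRing) : Prop :=
  ∃ I ∈ G.carrier, ∀ x ∈ I, q * QuotientRing.of G x = QuotientRing.of G (f x)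

namespace Represents

theorem exists_of_forall {f : Module.End k A} {I : RightIdeal A} (hI : I ∈ G.carrier)
    (h : ∀ x ∈ I, ∀ y, f (x * y) = f x * y) : ∃ q : G.QuotientRing, Represents f q := by
  let α : G.PartialHom := ⟨⟨I,
    { toFun := fun x => f x
      map_add' := fun x y => map_add f _ _
      map_smul' := fun c x => h x x.2 c.unop }⟩, hI⟩
  exact ⟨QuotientRing.mk α, I, hI, fun x hx => QuotientRing.mk_mul_of α hx⟩

/-- Partial homomorphisms are `k`-linear, and over a field they extend to all of `A`; the extension
need not be right `A`-linear outside the domain. -/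
theorem exists_linearMap (q : G.QuotientRing) : ∃ f : Module.End k A, Represents f q := by
  obtain ⟨α, rfl⟩ := QuotientRing.mk_surjective q
  have hc : ∀ (c : k) (x : A), c • x = x * algebraMap k A c := fun c x => by
    rw [Algebra.smul_def, Algebra.commutes]
  let V : Submodule k A :=
    { carrier := α.1.domain
      add_mem' := fun hx hy => α.1.domain.add_mem hx hy
      zero_mem' := α.1.domain.zero_mem
      smul_mem' := fun c x hx => by rw [hc]; exact RightIdeal.mul_mem α.1.domain hx _ }
  let g : V →ₗ[k] A :=
    { toFun := fun x => α.1 ⟨x.1, x.2⟩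
      map_add' := fun x y => PartialHom.val_add α _ _ _
      map_smul' := fun c x => by
        rw [RingHom.id_apply, hc]
        refine Eq.trans ?_ (PartialHom.val_mul α (algebraMap k A c) x.2
          (RightIdeal.mul_mem α.1.domain x.2 _))
        exact PartialHom.val_congr α (hc c x.1) _ _ }
  obtain ⟨f, hf⟩ := LinearMap.exists_extend g
  refine ⟨f, _, α.2, fun x hx => ?_⟩
  rw [QuotientRing.mk_mul_of α hx]
  exact congrArg _ (LinearMap.congr_fun hf ⟨x, hx⟩).symm

theorem eq {f : Module.End k A} {p q : G.QuotientRing} (hG : G.IsTorsionFree)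
    (hp : Represents f p) (hq : Represents f q) : p = q := by
  obtain ⟨I, hI, h⟩ := hp
  obtain ⟨J, hJ, h'⟩ := hq
  exact QuotientRing.eq_of_mul_of hG (G.inf_mem _ _ hI hJ) fun x hx => by
    rw [h x hx.1, h' x hx.2]

theorem add {f g : Module.End k A} {p q : G.QuotientRing} (hp : Represents f p)
    (hq : Represents g q) : Represents (f + g) (p + q) := by
  obtain ⟨I, hI, h⟩ := hp
  obtain ⟨J, hJ, h'⟩ := hq
  exact ⟨_, G.inf_mem _ _ hI hJ, fun x hx => by
    rw [add_mul, h x hx.1, h' x hx.2, LinearMap.add_apply, map_add]⟩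

theorem zero : Represents (0 : Module.End k A) (0 : G.QuotientRing) :=
  ⟨⊤, G.top_mem, fun x _ => by simp⟩

theorem smul {f : Module.End k A} {q : G.QuotientRing} (c : k) (hq : Represents f q) :
    Represents (c • f) (c • q) := by
  obtain ⟨I, hI, h⟩ := hq
  refine ⟨I, hI, fun x hx => ?_⟩
  rw [smul_mul_assoc, h x hx, LinearMap.smul_apply, Algebra.smul_def, Algebra.smul_def, map_mul]
  rfl

theorem sum {ι : Type*} (s : Finset ι) {f : ι → Module.End k A} {q : ι → G.QuotientRing}
    (h : ∀ i ∈ s, Represents (f i) (q i)) : Represents (∑ i ∈ s, f i) (∑ i ∈ s, q i) := by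
  classical
  induction s using Finset.induction_on with
  | empty => simpa using zero
  | insert i s hi ih =>
    rw [Finset.sum_insert hi, Finset.sum_insert hi]
    exact (h i (Finset.mem_insert_self i s)).add
      (ih fun j hj => h j (Finset.mem_insert_of_mem hj))

theorem mul {f g : Module.End k A} {p q : G.QuotientRing} (hG : G.IsTorsionFree) (hp : Represents f p)
    (hq : Represents g q) : Represents (f * g) (p * q) := by
  obtain ⟨I, hI, h⟩ := hp
  obtain ⟨J, hJ, h'⟩ := hq
  let K : RightIdeal A :=
    { carrier := {x | ∃ a ∈ I, q * QuotientRing.of G x = QuotientRing.of G a}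
      add_mem' := fun ⟨a, ha, hxa⟩ ⟨b, hb, hxb⟩ => ⟨a + b, I.add_mem ha hb, by
        rw [map_add, mul_add, hxa, hxb, map_add]⟩
      zero_mem' := ⟨0, I.zero_mem, by simp⟩
      smul_mem' := fun c x ⟨a, ha, hxa⟩ => ⟨a * c.unop, RightIdeal.mul_mem I ha _, by
        rw [MulOpposite.smul_eq_mul_unop, map_mul, ← mul_assoc, hxa, map_mul]⟩ }
  have hK : K ∈ G.carrier := by
    refine G.mem_of_colon_mem _ _ hJ fun a ha => ?_
    refine G.mem_of_le _ _ (G.colon_mem _ hI (g a)) fun r hr => ⟨g a * r, hr, ?_⟩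
    change q * QuotientRing.of G (a * r) = _
    rw [map_mul, ← mul_assoc, h' a ha, map_mul]
  refine ⟨_, G.inf_mem _ _ hK hJ, fun x ⟨⟨a, ha, hxa⟩, hxJ⟩ => ?_⟩
  have hga : a = g x := QuotientRing.of_injective G hG (hxa.symm.trans (h' x hxJ))
  rw [mul_assoc, hxa, h a ha, hga]
  rfl

theorem of (a : A) : Represents (LinearMap.mulLeft k a) (QuotientRing.of G a) :=
  ⟨⊤, G.top_mem, fun x _ => by rw [LinearMap.mulLeft_apply, map_mul]⟩

end Represents

section Action

variable [Module H A] [IsModuleAlgebra k H A]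

variable (k H G) in
/-- The topology is stable under the operations associated with comatrices over `H`. -/
def IsStable : Prop := ∀ (n : ℕ) (e : Matrix (Fin n) (Fin n) H) (he : IsComatrix k e),
  ∀ I ∈ G.carrier, he.antipodeComap I ∈ G.carrier

namespace Represents

/-- If `f` vanishes on `I`, then the transform by `e i j` vanishes on `antipodeComap I`. So the
action on `Q` does not depend on the chosen extension. -/
theorem homAction_zero (hst : IsStable k H G) {f : Module.End k A}
    (hf : Represents f (0 : G.QuotientRing)) (hG : G.IsTorsionFree) (h : H) :
    Represents (homAction k H A h f) (0 : G.QuotientRing) := by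
  obtain ⟨I, hI, hfI⟩ := hf
  have hfI' : ∀ x ∈ I, f x = 0 := fun x hx => QuotientRing.of_injective G hG (by
    rw [← hfI x hx, zero_mul, map_zero])
  refine forall_of_isComatrix (k := k)
    (P := fun h => Represents (homAction k H A h f) (0 : G.QuotientRing))
    (fun x y hx hy => ?_) ?_ (fun c x hx => ?_)
    (fun n e he i j => ⟨_, hst n e he I hI, fun x hx => ?_⟩) h
  · rw [map_add, LinearMap.add_apply]
    simpa using hx.add hy
  · rw [map_zero]
    exact zero
  · rw [map_smul, LinearMap.smul_apply]
    simpa using hx.smul c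
  · rw [he.homAction_apply, Finset.sum_eq_zero fun l _ => by rw [hfI' _ (hx l j), smul_zero],
      zero_mul, map_zero]

/-- If `f` is right linear on `I`, its transform by `e i j` is right linear on `antipodeComap I`,
where only values of `f` on `I` enter. -/
theorem exists_homAction (hst : IsStable k H G) (hG : G.IsTorsionFree) {f : Module.End k A}
    {q : G.QuotientRing} (hf : Represents f q) (h : H) :
    ∃ p : G.QuotientRing, Represents (homAction k H A h f) p := by
  obtain ⟨I, hI, hfI⟩ := hf
  have hlin : ∀ x ∈ I, ∀ y, f (x * y) = f x * y := fun x hx y =>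
    QuotientRing.of_injective G hG (by
      rw [← hfI _ (RightIdeal.mul_mem I hx y), map_mul, map_mul, ← mul_assoc, hfI x hx])
  refine forall_of_isComatrix (k := k)
    (P := fun h => ∃ p : G.QuotientRing, Represents (homAction k H A h f) p)
    (fun x y ⟨p, hp⟩ ⟨p', hp'⟩ => ⟨p + p', ?_⟩) ⟨0, ?_⟩ (fun c x ⟨p, hp⟩ => ⟨c • p, ?_⟩)
    (fun n e he i j => exists_of_forall (hst n e he I hI) fun x hx y => ?_) h
  · rw [map_add, LinearMap.add_apply]
    exact hp.add hp'
  · rw [map_zero]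
    exact zero
  · rw [map_smul, LinearMap.smul_apply]
    exact hp.smul c
  · simp only [he.homAction_apply, he.antipode_smul_mul, map_sum, Finset.smul_sum, Finset.sum_mul]
    rw [Finset.sum_comm]
    refine Finset.sum_congr rfl fun m _ => ?_
    rw [he.smul_mul_eq_sum]
    exact Finset.sum_congr rfl fun l _ => by rw [hlin _ (hx m j)]

end Represents

variable (hst : IsStable k H G) (hG : G.IsTorsionFree)

/-- The action of `H` on the quotient ring. -/
noncomputable def QuotientRing.act (hst : IsStable k H G) (hG : G.IsTorsionFree) (h : H)
    (q : G.QuotientRing) : G.QuotientRing :=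
  (Represents.exists_homAction hst hG (Represents.exists_linearMap (k := k) q).choose_spec h).choose

theorem Represents.act {f : Module.End k A} {q : G.QuotientRing} (hf : Represents f q) (h : H) :
    Represents (homAction k H A h f) (QuotientRing.act hst hG h q) := by
  have hg := (Represents.exists_linearMap (k := k) q).choose_spec
  set g := (Represents.exists_linearMap (k := k) q).choose
  have hq : Represents (homAction k H A h g) (QuotientRing.act hst hG h q) :=
    (Represents.exists_homAction hst hG hg h).choose_spec
  -- The given and the chosen representatives differ by a map representing zero.
  have h0 : Represents (f - g) (0 : G.QuotientRing) := by
    have := hf.add (hg.smul (-1 : k))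
    have h1 : f + (-1 : k) • g = f - g := by
      ext x
      simp [sub_eq_add_neg]
    rwa [h1, neg_one_smul, add_neg_cancel] at this
  have := hq.add (h0.homAction_zero hst hG h)
  rwa [← map_add, add_sub_cancel, add_zero] at this

/-- The `H`-module structure on the quotient ring with respect to a stable topology. -/
noncomputable abbrev QuotientRing.moduleOfIsStable : Module H G.QuotientRing where
  smul := QuotientRing.act hst hG
  one_smul q := by
    obtain ⟨f, hf⟩ := Represents.exists_linearMap (k := k) q
    have := hf.act hst hG 1
    rw [homAction_one] at this
    exact this.eq hG hf
  mul_smul g h q := by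
    obtain ⟨f, hf⟩ := Represents.exists_linearMap (k := k) q
    have := hf.act hst hG (g * h)
    rw [homAction_mul] at this
    exact this.eq hG ((hf.act hst hG h).act hst hG g)
  smul_zero h := by
    have := Represents.zero.act hst hG h
    rw [map_zero] at this
    exact this.eq hG Represents.zero
  smul_add h p q := by
    obtain ⟨f, hf⟩ := Represents.exists_linearMap (k := k) p
    obtain ⟨g, hg⟩ := Represents.exists_linearMap (k := k) q
    have := (hf.add hg).act hst hG h
    rw [map_add] at this
    exact this.eq hG ((hf.act hst hG h).add (hg.act hst hG h))
  add_smul g h q := by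
    obtain ⟨f, hf⟩ := Represents.exists_linearMap (k := k) q
    have := hf.act hst hG (g + h)
    rw [map_add] at this
    exact this.eq hG ((hf.act hst hG g).add (hf.act hst hG h))
  zero_smul q := by
    obtain ⟨f, hf⟩ := Represents.exists_linearMap (k := k) q
    have := hf.act hst hG 0
    rw [map_zero] at this
    exact this.eq hG Represents.zero

theorem QuotientRing.isModuleAlgebra_moduleOfIsStable :
    letI := QuotientRing.moduleOfIsStable hst hG
    IsModuleAlgebra k H G.QuotientRing := by
  let _ := QuotientRing.moduleOfIsStable hst hG
  have hact : ∀ (f : Module.End k A) (q : G.QuotientRing), Represents f q → ∀ h : H,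
      Represents (homAction k H A h f) (h • q) := fun f q hf h => hf.act hst hG h
  have : IsScalarTower k H G.QuotientRing := ⟨fun c h q => by
    obtain ⟨f, hf⟩ := Represents.exists_linearMap (k := k) q
    have := hact f q hf (c • h)
    rw [map_smul] at this
    exact this.eq hG ((hact f q hf h).smul c)⟩
  refine { smul_mul := fun h p q => ?_ }
  refine forall_of_isComatrix (k := k) (P := fun h => h • (p * q) =
    LinearMap.mul' k G.QuotientRing (TensorProduct.map
      ((LinearMap.toSpanSingleton H G.QuotientRing p).restrictScalars k)
      ((LinearMap.toSpanSingleton H G.QuotientRing q).restrictScalars k)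
      (Coalgebra.comul (R := k) h))) (fun x y hx hy => ?_) ?_ (fun c x hx => ?_)
    (fun n e he i j => ?_) h
  · rw [add_smul, hx, hy, map_add, map_add, map_add]
  · rw [zero_smul, map_zero, map_zero, map_zero]
  · rw [smul_assoc, hx, map_smul, map_smul, map_smul]
  · obtain ⟨f, hf⟩ := Represents.exists_linearMap (k := k) p
    obtain ⟨g, hg⟩ := Represents.exists_linearMap (k := k) q
    have h1 := hact _ _ (hf.mul hG hg) (e i j)
    rw [he.homAction_mul_apply] at h1
    have h2 := Represents.sum Finset.univ fun l _ =>
      (hact f p hf (e i l)).mul hG (hact g q hg (e l j))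
    rw [h1.eq hG h2, he.comul_eq]
    simp

theorem QuotientRing.moduleOfIsStable_smul_of (h : H) (a : A) :
    letI := QuotientRing.moduleOfIsStable hst hG
    h • QuotientRing.of G a = QuotientRing.of G (h • a) := by
  have h1 := (Represents.of (k := k) (G := G) a).act hst hG h
  -- `∑ h₍₁₎ (a (S(h₍₂₎) b)) = (h a) b`.
  have h2 : homAction k H A h (LinearMap.mulLeft k a) = LinearMap.mulLeft k (h • a) := by
    refine forall_of_isComatrix (k := k) (P := fun h => homAction k H A h (LinearMap.mulLeft k a) =
      LinearMap.mulLeft k (h • a)) (fun x y hx hy => ?_) ?_ (fun c x hx => ?_)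
      (fun n e he i j => ?_) h
    · rw [map_add, LinearMap.add_apply, hx, hy]
      ext b; simp [add_smul, add_mul]
    · ext b; simp
    · rw [map_smul, LinearMap.smul_apply, hx]
      ext b; simp
    · ext b
      rw [he.homAction_apply, LinearMap.mulLeft_apply, he.smul_mul_eq_sum]
      rfl
  rw [h2] at h1
  exact h1.eq hG (Represents.of _)

end Action

/-- An extension of the action to the quotient ring preserves `H`-semiprimeness. -/
theorem QuotientRing.isHSemiprime [Module H A] (hsemi : IsHSemiprime H A)
    [Module H G.QuotientRing] (hG : G.IsTorsionFree)
    (hof : ∀ (h : H) (a : A), h • QuotientRing.of G a = QuotientRing.of G (h • a)) :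
    IsHSemiprime H G.QuotientRing := by
  intro I hI hst ⟨n, hn⟩
  have hT : I.comap (QuotientRing.of G) = ⊥ := by
    refine hsemi _ inferInstance (fun h a ha => ?_) ⟨n, le_bot_iff.1 fun x hx => ?_⟩
    · rw [Ideal.mem_comap, ← hof]
      exact hst h _ ha
    · have key : ∀ n : ℕ, ∀ x ∈ (I.comap (QuotientRing.of G)) ^ n, QuotientRing.of G x ∈ I ^ n := by
        intro n
        induction n with
        | zero => intro x _; rw [Submodule.pow_zero, Ideal.one_eq_top]; trivial
        | succ n ih =>
          intro x hx
          rw [Submodule.pow_succ] at hx ⊢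
          refine Submodule.smul_induction_on hx (fun r hr a ha => ?_) fun x y hx hy => ?_
          · rw [smul_eq_mul, map_mul]
            exact Ideal.mul_mem_mul (ih r hr) ha
          · rw [map_add]
            exact Ideal.add_mem _ hx hy
      have := key n x hx
      rw [hn] at this
      exact QuotientRing.of_injective G hG
        (((Submodule.mem_bot _).1 this).trans (map_zero (QuotientRing.of G)).symm)
  refine le_bot_iff.1 fun q hq => ?_
  -- The multiples of `q` by its denominators lie in `I ∩ A`, which is zero.
  refine QuotientRing.eq_zero_of_mul_of hG (QuotientRing.denominators_mem q) fun x ⟨a, ha⟩ => ?_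
  have h1 : a ∈ I.comap (QuotientRing.of G) := by
    rw [Ideal.mem_comap, ← ha]
    exact I.mul_mem_right _ hq
  rw [hT, Submodule.mem_bot] at h1
  rw [ha, h1, map_zero]

end RightGabrielTopology

end ExtensionOfAction

theorem proposition2p2 {k H A : Type*} [Field k] [Ring H] [HopfAlgebra k H]
    [Ring A] [Algebra k A] [Module H A] [IsModuleAlgebra k H A]
    (hsemi : IsHSemiprime H A) (hnoeth : IsNoetherian Aᵐᵒᵖ A) :
    ∃ G : RightGabrielTopology A,
      G.carrier = hEssentialFilter k H A ∧
      G.IsTorsionFree ∧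
      IsSemiprimaryRing G.QuotientRing ∧
      ∃ _ : Module H G.QuotientRing,
        IsModuleAlgebra k H G.QuotientRing ∧
        (∀ (h : H) (a : A),
          h • RightGabrielTopology.QuotientRing.of G a =
            RightGabrielTopology.QuotientRing.of G (h • a)) ∧
        IsHSemiprime H G.QuotientRing := by
  have hG := isTorsionFree_hEssentialTopology (k := k) hsemi
  have hst : RightGabrielTopology.IsStable k H (hEssentialTopology k hsemi) :=
    fun _ _ he _ hI => he.antipodeComap_mem_hEssentialFilter hI
  have hof := RightGabrielTopology.QuotientRing.moduleOfIsStable_smul_of hst hG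
  refine ⟨hEssentialTopology k hsemi, rfl, hG,
    RightGabrielTopology.QuotientRing.isSemiprimaryRing hG
      (hasDenseChains_hEssentialTopology hsemi),
    RightGabrielTopology.QuotientRing.moduleOfIsStable hst hG,
    RightGabrielTopology.QuotientRing.isModuleAlgebra_moduleOfIsStable hst hG, hof, ?_⟩
  let _ := RightGabrielTopology.QuotientRing.moduleOfIsStable hst hG
  exact RightGabrielTopology.QuotientRing.isHSemiprime hsemi hG hof
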